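/- Let $\mathcal H$ be the twisted Heisenberg--Virasoro algebra, the complex Lie algebra with basis $L(n),I(n)$ $(n\in\mathbb Z)$, $C_L,C_{LI},C_I$, where $C_L,C_{LI},C_I$ are central and $$[L(n),L(m)]=(n-m)L(n+m)+\delta_{n,-m}\tfrac{n^3-n}{12}C_L,\quad [L(n),I(m)]=-mI(n+m)-\delta_{n,-m}(n^2+n)C_{LI},\quad [I(n),I(m)]=n\delta_{n,-m}C_I,$$ and let $W(2,2)$ be the complex Lie algebra with basis $L(n),W(n)$ $(n\in\mathbb Z)$, $C,C_W$, where $C,C_W$ are central and $$[L(n),L(m)]=(n-m)L(n+m)+\delta_{n,-m}\tfrac{n^3-n}{12}C,\quad [L(n),W(m)]=(n-m)W(n+m)+\delta_{n,-m}\tfrac{n^3-n}{12}C_W,\quad [W(n),W(m)]=0.$$ Let $V^{\mathcal H}(c_L,0,c_{L,I},h,h_I)$ be the Verma module over $\mathcal H$ with highest weight vector $v_{h,h_I}$, on which $L(0),I(0),C_L,C_I,C_{LI}$ act by $h,h_I,c_L,0,c_{L,I}$, and let $V^{W(2,2)}(c_L,c_W,h,h_W)$ be the Verma module over $W(2,2)$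 with highest weight vector $v_{h,h_W}$, on which $L(0),W(0),C,C_W$ act by $h,h_W,c_L,c_W$. The Schur polynomials $S_r$ are defined by $\exp\bigl(\sum_{n\ge1}\frac{x_n}{n}y^n\bigr)=\sum_{r\ge0}S_r(x_1,x_2,\dots)y^r$. Let $p$ be a positive integer and let $c_L,c_W,h,h_W,c_{L,I},h_I\in\mathbb C$ with $c_{L,I}\ne0$ be such that $$\frac{h_W}{c_W}=\frac{1-p^2}{24},\qquad c_W=-24c_{L,I}^2,\qquad h_W=h_I(h_I-2c_{L,I}),\qquad \frac{h_I}{c_{L,I}}-1=p .$$ Then $V^{\mathcal H}(c_L,0,c_{L,I},h,h_I)$ is a $W(2,2)$-module on which $L(n)$ acts by $L(n)$, $C$ by $c_L$, $C_W$ by $c_W$, and $W(n)$ by the coefficient of $z^{-n-2}$ in ${:}I(z)^2{:}+2c_{L,I}\,\partial_zI(z)$, that is, by $\sum_{i\in\mathbb Z}{:}I(i)I(n-i){:}-2c_{L,I}(n+1)I(n)$; let $$\Psi: V^{W(2,2)}(c_L,c_W,h,h_W)\to V^{\mathcal H}(c_L,0,c_{L,I},h,h_I)$$ be the $W(2,2)$-homomorphism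 with $\Psi(v_{h,h_W})=v_{h,h_I}$. Then the vector $$S_p\Bigl(-\frac{I(-1)}{c_{L,I}},-\frac{I(-2)}{c_{L,I}},\dots\Bigr)v_{h,h_I}$$ has exactly one preimage $u$ under $\Psi$, and $u$ is a singular vector of conformal weight $p$ in $V^{W(2,2)}(c_L,c_W,h,h_W)$: $u\neq0$, $L(n)u=W(n)u=0$ for all $n>0$, $L(0)u=(h+p)u$, and $u$ is an eigenvector of $W(0)$. -/

import Mathlib

set_option linter.unusedSimpArgs false

namespace StructureConstants

variable {κ : Type*} (b : κ → κ → (κ →₀ ℂ))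

/-- The bilinear bracket on the vector space with basis `κ` determined by `⁅e i, e j⁆ = b i j`. -/
noncomputable def bracket : (κ →₀ ℂ) →ₗ[ℂ] (κ →₀ ℂ) →ₗ[ℂ] (κ →₀ ℂ) :=
  Finsupp.linearCombination ℂ fun i => Finsupp.linearCombination ℂ (b i)

@[simp] theorem bracket_single (i j : κ) :
    bracket b (Finsupp.single i 1) (Finsupp.single j 1) = b i j := by
  simp [bracket]

theorem bracket_skew (hskew : ∀ i j, b i j = -b j i) (x y : κ →₀ ℂ) :
    bracket b x y = -bracket b y x := by
  induction x using Finsupp.induction_linear with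
  | zero => simp
  | add x₁ x₂ h₁ h₂ => simp only [map_add, LinearMap.add_apply, h₁, h₂, neg_add]
  | single i r =>
    induction y using Finsupp.induction_linear with
    | zero => simp
    | add x₁ x₂ h₁ h₂ => simp only [map_add, LinearMap.add_apply, h₁, h₂, neg_add]
    | single j s =>
      rw [← Finsupp.smul_single_one i r, ← Finsupp.smul_single_one j s]
      simp only [map_smul, LinearMap.smul_apply, bracket_single, hskew i j, smul_neg]
      rw [smul_comm]

theorem bracket_self (hskew : ∀ i j, b i j = -b j i) (x : κ →₀ ℂ) : bracket b x x = 0 :=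
  self_eq_neg.mp (bracket_skew b hskew x x)

theorem bracket_leibniz
    (hjac : ∀ i j k, bracket b (Finsupp.single i 1) (b j k) =
      bracket b (b i j) (Finsupp.single k 1) + bracket b (Finsupp.single j 1) (b i k))
    (x y z : κ →₀ ℂ) :
    bracket b x (bracket b y z) = bracket b (bracket b x y) z + bracket b y (bracket b x z) := by
  induction x using Finsupp.induction_linear with
  | zero => simp
  | add x₁ x₂ h₁ h₂ => simp only [map_add, LinearMap.add_apply, h₁, h₂]; abel
  | single i r =>
    induction y using Finsupp.induction_linear with
    | zero => simp
    | add x₁ x₂ h₁ h₂ => simp only [map_add, LinearMap.add_apply, h₁, h₂]; abel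
    | single j s =>
      induction z using Finsupp.induction_linear with
      | zero => simp
      | add x₁ x₂ h₁ h₂ => simp only [map_add, h₁, h₂]; abel
      | single k t =>
        rw [← Finsupp.smul_single_one i r, ← Finsupp.smul_single_one j s,
          ← Finsupp.smul_single_one k t]
        simp only [map_smul, LinearMap.smul_apply, bracket_single]
        rw [hjac i j k]
        simp only [smul_add]
        rw [smul_comm t s, smul_comm t r, smul_comm s r]
        congr 1
        rw [smul_comm s r]

end StructureConstants

/-- Basis of the twisted Heisenberg-Virasoro algebra. -/
inductive HVirBasis : Type
  | L (n : ℤ)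
  | I (n : ℤ)
  | CL
  | CLI
  | CI

/-- Basis of the Lie algebra `W(2,2)`. -/
inductive W22Basis : Type
  | L (n : ℤ)
  | W (n : ℤ)
  | C
  | CW

open Finsupp in
/-- Brackets of basis elements of the twisted Heisenberg-Virasoro algebra. -/
noncomputable def HVirBasis.br : HVirBasis → HVirBasis → (HVirBasis →₀ ℂ)
  | .L n, .L m => single (.L (n + m)) ((n : ℂ) - m) +
      single .CL (if n = -m then ((n : ℂ) ^ 3 - n) / 12 else 0)
  | .L n, .I m => single (.I (n + m)) (-(m : ℂ)) -
      single .CLI (if n = -m then (n : ℂ) ^ 2 + n else 0)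
  | .I m, .L n => -(single (.I (n + m)) (-(m : ℂ)) -
      single .CLI (if n = -m then (n : ℂ) ^ 2 + n else 0))
  | .I n, .I m => single .CI (if n = -m then (n : ℂ) else 0)
  | _, _ => 0

open Finsupp in
/-- Brackets of basis elements of `W(2,2)`. -/
noncomputable def W22Basis.br : W22Basis → W22Basis → (W22Basis →₀ ℂ)
  | .L n, .L m => single (.L (n + m)) ((n : ℂ) - m) +
      single .C (if n = -m then ((n : ℂ) ^ 3 - n) / 12 else 0)
  | .L n, .W m => single (.W (n + m)) ((n : ℂ) - m) +
      single .CW (if n = -m then ((n : ℂ) ^ 3 - n) / 12 else 0)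
  | .W m, .L n => -(single (.W (n + m)) ((n : ℂ) - m) +
      single .CW (if n = -m then ((n : ℂ) ^ 3 - n) / 12 else 0))
  | _, _ => 0

open Finsupp in
theorem HVirBasis.br_skew (i j : HVirBasis) : i.br j = -j.br i := by
  rcases i with n | n | _ | _ | _ <;> rcases j with m | m | _ | _ | _ <;>
    simp only [HVirBasis.br, neg_zero, neg_neg]
  · rw [neg_add, ← single_neg, ← single_neg, add_comm m n, neg_sub]
    congr 2
    by_cases h : n = -m
    · subst h; simp; ring
    · rw [if_neg h, if_neg (by omega), neg_zero]
  · rw [← single_neg]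
    congr 1
    by_cases h : n = -m
    · subst h; simp
    · rw [if_neg h, if_neg (by omega), neg_zero]

open Finsupp in
theorem W22Basis.br_skew (i j : W22Basis) : i.br j = -j.br i := by
  rcases i with n | n | _ | _ <;> rcases j with m | m | _ | _ <;>
    simp only [W22Basis.br, neg_zero, neg_neg]
  rw [neg_add, ← single_neg, ← single_neg, add_comm m n, neg_sub]
  congr 2
  by_cases h : n = -m
  · subst h; simp; ring
  · rw [if_neg h, if_neg (by omega), neg_zero]

open StructureConstants Finsupp in
theorem HVirBasis.br_jacobi (i j k : HVirBasis) :
    bracket HVirBasis.br (Finsupp.single i 1) (j.br k) =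
      bracket HVirBasis.br (i.br j) (Finsupp.single k 1) +
        bracket HVirBasis.br (Finsupp.single j 1) (i.br k) := by
  rcases i with n | n | _ | _ | _ <;> rcases j with m | m | _ | _ | _ <;>
    rcases k with l | l | _ | _ | _ <;>
    simp only [HVirBasis.br, bracket, map_add, map_sub, map_neg, map_zero, LinearMap.add_apply,
      LinearMap.sub_apply, LinearMap.neg_apply, LinearMap.zero_apply, linearCombination_single,
      LinearMap.smul_apply, smul_zero, one_smul, add_zero, zero_add, sub_zero, neg_zero]
  all_goals
    try simp only [add_comm (G := ℤ), add_left_comm (G := ℤ)]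
    classical
    ext q
    simp only [Finsupp.coe_add, Finsupp.coe_sub, Finsupp.coe_neg, Finsupp.coe_smul, Pi.add_apply,
      Pi.sub_apply, Pi.neg_apply, Pi.smul_apply, smul_eq_mul, Finsupp.single_apply,
      Finsupp.coe_zero, Pi.zero_apply]
    by_cases h : n + m + l = 0
    · obtain rfl : l = -n - m := by omega
      repeat rw [if_pos (by omega : (_ : ℤ) = _)]
      split_ifs <;> push_cast <;> ring
    · repeat rw [if_neg (by omega : ¬ ((_ : ℤ) = _))]
      split_ifs <;> push_cast <;> ring

open StructureConstants Finsupp in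
theorem W22Basis.br_jacobi (i j k : W22Basis) :
    bracket W22Basis.br (Finsupp.single i 1) (j.br k) =
      bracket W22Basis.br (i.br j) (Finsupp.single k 1) +
        bracket W22Basis.br (Finsupp.single j 1) (i.br k) := by
  rcases i with n | n | _ | _ <;> rcases j with m | m | _ | _ <;>
    rcases k with l | l | _ | _ <;>
    simp only [W22Basis.br, bracket, map_add, map_sub, map_neg, map_zero, LinearMap.add_apply,
      LinearMap.sub_apply, LinearMap.neg_apply, LinearMap.zero_apply, linearCombination_single,
      LinearMap.smul_apply, smul_zero, one_smul, add_zero, zero_add, sub_zero, neg_zero]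
  all_goals
    try simp only [add_comm (G := ℤ), add_left_comm (G := ℤ)]
    classical
    ext q
    simp only [Finsupp.coe_add, Finsupp.coe_sub, Finsupp.coe_neg, Finsupp.coe_smul, Pi.add_apply,
      Pi.sub_apply, Pi.neg_apply, Pi.smul_apply, smul_eq_mul, Finsupp.single_apply,
      Finsupp.coe_zero, Pi.zero_apply]
    by_cases h : n + m + l = 0
    · obtain rfl : l = -n - m := by omega
      repeat rw [if_pos (by omega : (_ : ℤ) = _)]
      split_ifs <;> push_cast <;> ring
    · repeat rw [if_neg (by omega : ¬ ((_ : ℤ) = _))]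
      split_ifs <;> push_cast <;> ring

theorem StructureConstants.linearCombination_bracket {κ : Type*} (b : κ → κ → (κ →₀ ℂ))
    {A : Type*} [Ring A] [Algebra ℂ A] (φ : κ → A)
    (hφ : ∀ i j, Finsupp.linearCombination ℂ φ (b i j) = φ i * φ j - φ j * φ i)
    (x y : κ →₀ ℂ) :
    Finsupp.linearCombination ℂ φ (StructureConstants.bracket b x y) =
      Finsupp.linearCombination ℂ φ x * Finsupp.linearCombination ℂ φ y -
        Finsupp.linearCombination ℂ φ y * Finsupp.linearCombination ℂ φ x := by
  induction x using Finsupp.induction_linear with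
  | zero => simp
  | add x₁ x₂ h₁ h₂ =>
    simp only [map_add, LinearMap.add_apply, h₁, h₂, add_mul, mul_add]; abel
  | single i r =>
    induction y using Finsupp.induction_linear with
    | zero => simp
    | add x₁ x₂ h₁ h₂ =>
      simp only [map_add, h₁, h₂, add_mul, mul_add]; abel
    | single j s =>
      rw [← Finsupp.smul_single_one i r, ← Finsupp.smul_single_one j s]
      simp only [map_smul, LinearMap.smul_apply, StructureConstants.bracket_single, hφ,
        Finsupp.linearCombination_single, one_smul, smul_mul_assoc, mul_smul_comm, smul_sub]
      rw [smul_comm s r (φ j * φ i)]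

/-- The twisted Heisenberg-Virasoro algebra: the complex vector space with basis
`L n, I n (n : ℤ), C_L, C_LI, C_I`. -/
def HVir : Type := HVirBasis →₀ ℂ

/-- The Lie algebra `W(2,2)`: the complex vector space with basis `L n, W n (n : ℤ), C, C_W`. -/
def W22 : Type := W22Basis →₀ ℂ

namespace HVir

noncomputable instance : AddCommGroup HVir := inferInstanceAs (AddCommGroup (HVirBasis →₀ ℂ))

noncomputable instance : Module ℂ HVir := inferInstanceAs (Module ℂ (HVirBasis →₀ ℂ))

/-- The Lie bracket, determined by the brackets of the basis elements. -/
noncomputable instance : LieRing HVir where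
  bracket x y := StructureConstants.bracket HVirBasis.br x y
  add_lie x y z := LinearMap.map_add₂ (StructureConstants.bracket HVirBasis.br) x y z
  lie_add x y z := map_add (StructureConstants.bracket HVirBasis.br x) y z
  lie_self x := StructureConstants.bracket_self _ HVirBasis.br_skew x
  leibniz_lie x y z := StructureConstants.bracket_leibniz _ HVirBasis.br_jacobi x y z

noncomputable instance : LieAlgebra ℂ HVir where
  lie_smul t x y := map_smul (StructureConstants.bracket HVirBasis.br x) t y

/-- The basis element of `HVir` with index `i`. -/
noncomputable def e (i : HVirBasis) : HVir := Finsupp.single i (1 : ℂ)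

theorem lie_e (i j : HVirBasis) : ⁅e i, e j⁆ = (HVirBasis.br i j : HVirBasis →₀ ℂ) :=
  StructureConstants.bracket_single _ i j

end HVir

namespace W22

noncomputable instance : AddCommGroup W22 := inferInstanceAs (AddCommGroup (W22Basis →₀ ℂ))

noncomputable instance : Module ℂ W22 := inferInstanceAs (Module ℂ (W22Basis →₀ ℂ))

/-- The Lie bracket, determined by the brackets of the basis elements. -/
noncomputable instance : LieRing W22 where
  bracket x y := StructureConstants.bracket W22Basis.br x y
  add_lie x y z := LinearMap.map_add₂ (StructureConstants.bracket W22Basis.br) x y z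
  lie_add x y z := map_add (StructureConstants.bracket W22Basis.br x) y z
  lie_self x := StructureConstants.bracket_self _ W22Basis.br_skew x
  leibniz_lie x y z := StructureConstants.bracket_leibniz _ W22Basis.br_jacobi x y z

noncomputable instance : LieAlgebra ℂ W22 where
  lie_smul t x y := map_smul (StructureConstants.bracket W22Basis.br x) t y

/-- The basis element of `W22` with index `i`. -/
noncomputable def e (i : W22Basis) : W22 := Finsupp.single i (1 : ℂ)

end W22

section Universal

attribute [local instance 100] LieRing.ofAssociativeRing

/-- Every subalgebra of `U(g)` containing the image of `g` is everything. -/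
theorem UniversalEnvelopingAlgebra.induction_of_generators {g : Type*} [LieRing g]
    [LieAlgebra ℂ g] (S : Subalgebra ℂ (UniversalEnvelopingAlgebra ℂ g))
    (hS : ∀ x : g, UniversalEnvelopingAlgebra.ι ℂ x ∈ S)
    (u : UniversalEnvelopingAlgebra ℂ g) : u ∈ S := by
  let f : g →ₗ⁅ℂ⁆ S :=
    { toFun := fun x => ⟨UniversalEnvelopingAlgebra.ι ℂ x, hS x⟩
      map_add' := fun x y => by ext; simp
      map_smul' := fun t x => by ext; simp
      map_lie' := fun {x y} => by
        ext
        simp [LieRing.of_associative_ring_bracket] }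
  have h : AlgHom.id ℂ _ = S.val.comp (UniversalEnvelopingAlgebra.lift ℂ f) := by
    ext x
    simp [f]
  have h' := congrArg (fun F => F u) h
  simp only [AlgHom.id_apply] at h'
  change u = ((UniversalEnvelopingAlgebra.lift ℂ f) u : UniversalEnvelopingAlgebra ℂ g) at h'
  rw [h']
  exact Subtype.prop _

theorem UniversalEnvelopingAlgebra.ι_lie {g : Type*} [LieRing g] [LieAlgebra ℂ g] (x y : g) :
    UniversalEnvelopingAlgebra.ι ℂ ⁅x, y⁆ =
      UniversalEnvelopingAlgebra.ι ℂ x * UniversalEnvelopingAlgebra.ι ℂ y -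
        UniversalEnvelopingAlgebra.ι ℂ y * UniversalEnvelopingAlgebra.ι ℂ x := by
  rw [LieHom.map_lie, LieRing.of_associative_ring_bracket]

end Universal

/-- Operators `L n`, `I n` on a vector space `V` that satisfy the relations of the twisted
Heisenberg-Virasoro algebra with `C_L = cL`, `C_LI = cLI`, `C_I = 0`, and such that every vector
is annihilated by `I n` for `n` large. -/
structure IsLevelZeroRep {V : Type*} [AddCommGroup V] [Module ℂ V] (L I : ℤ → Module.End ℂ V)
    (cL cLI : ℂ) : Prop where
  LL : ∀ (n m : ℤ) (x : V), L n (L m x) = L m (L n x) + ((n : ℂ) - m) • L (n + m) x +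
    (if n = -m then ((n : ℂ) ^ 3 - n) / 12 * cL else 0) • x
  LI : ∀ (n m : ℤ) (x : V), L n (I m x) = I m (L n x) + (-(m : ℂ)) • I (n + m) x -
    (if n = -m then ((n : ℂ) ^ 2 + n) * cLI else 0) • x
  II : ∀ (n m : ℤ) (x : V), I n (I m x) = I m (I n x)
  smooth : ∀ x : V, ∃ N : ℤ, ∀ n : ℤ, N ≤ n → I n x = 0

namespace IsLevelZeroRep

variable {V : Type*} [AddCommGroup V] [Module ℂ V] {L I : ℤ → Module.End ℂ V} {cL cLI : ℂ}

/-- The value at `x` of the normally ordered product `:I(i) I(j):`, in which the mode with the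
negative index is written on the left. -/
def normalOrdered (I : ℤ → Module.End ℂ V) (i j : ℤ) (x : V) : V :=
  if i < 0 then I i (I j x) else I j (I i x)

theorem normalOrdered_eq (H : IsLevelZeroRep L I cL cLI) (i j : ℤ) (x : V) :
    normalOrdered I i j x = I i (I j x) := by
  unfold normalOrdered
  split_ifs
  · rfl
  · exact H.II _ _ _

theorem finite_quad (H : IsLevelZeroRep L I cL cLI) (n : ℤ) (x : V) :
    (Function.support fun i : ℤ => I i (I (n - i) x)).Finite := by
  obtain ⟨N, hN⟩ := H.smooth x
  refine (Set.finite_Ioo (n - N) N).subset fun i hi => ?_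
  rw [Function.mem_support] at hi
  constructor
  · by_contra hlt
    exact hi (by rw [hN (n - i) (by omega), map_zero])
  · by_contra hlt
    exact hi (by rw [H.II, hN i (by omega), map_zero])

theorem finite_normalOrdered (H : IsLevelZeroRep L I cL cLI) (n : ℤ) (x : V) :
    (Function.support fun i : ℤ => normalOrdered I i (n - i) x).Finite := by
  simpa only [H.normalOrdered_eq] using H.finite_quad n x

/-- The mode `W n` of the field `W(z) = :I(z)²: + 2 cLI ∂I(z) = ∑ W n z^(-n-2)`, which is the
field of the vector `(I(-1)² + 2 cLI I(-2)) 𝟏`. -/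
noncomputable def wMode (H : IsLevelZeroRep L I cL cLI) (n : ℤ) : Module.End ℂ V where
  toFun x := (∑ᶠ i : ℤ, normalOrdered I i (n - i) x) - (2 * cLI * (n + 1)) • I n x
  map_add' x y := by
    have h : ∀ i : ℤ, normalOrdered I i (n - i) (x + y) =
        normalOrdered I i (n - i) x + normalOrdered I i (n - i) y := fun i => by
      simp only [H.normalOrdered_eq, map_add]
    simp only [h]
    rw [finsum_add_distrib (H.finite_normalOrdered n x) (H.finite_normalOrdered n y), map_add,
      smul_add]
    abel
  map_smul' t x := by
    have h : ∀ i : ℤ, normalOrdered I i (n - i) (t • x) = t • normalOrdered I i (n - i) x :=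
      fun i => by simp only [H.normalOrdered_eq, map_smul]
    simp only [h, RingHom.id_apply]
    rw [← smul_finsum, map_smul, smul_sub, smul_comm t]

theorem wMode_apply (H : IsLevelZeroRep L I cL cLI) (n : ℤ) (x : V) :
    H.wMode n x = (∑ᶠ i : ℤ, I i (I (n - i) x)) - (2 * cLI * (n + 1)) • I n x := by
  change (∑ᶠ i : ℤ, normalOrdered I i (n - i) x) - (2 * cLI * (n + 1)) • I n x = _
  simp only [H.normalOrdered_eq]

theorem map_finsum' (f : Module.End ℂ V) {g : ℤ → V} (hg : (Function.support g).Finite) :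
    f (∑ᶠ i, g i) = ∑ᶠ i, f (g i) :=
  f.toAddMonoidHom.map_finsum hg

theorem I_wMode (H : IsLevelZeroRep L I cL cLI) (k n : ℤ) (x : V) :
    I k (H.wMode n x) = H.wMode n (I k x) := by
  rw [wMode_apply, wMode_apply, map_sub, map_finsum' _ (H.finite_quad n x), map_smul, H.II k n]
  congr 1
  refine finsum_congr fun i => ?_
  rw [H.II k i, H.II k (n - i)]

theorem wMode_wMode (H : IsLevelZeroRep L I cL cLI) (m n : ℤ) (x : V) :
    H.wMode m (H.wMode n x) = H.wMode n (H.wMode m x) := by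
  rw [wMode_apply H m (H.wMode n x), wMode_apply H m x, map_sub,
    map_finsum' _ (H.finite_quad m x), map_smul]
  simp only [H.I_wMode]

theorem L_wMode (H : IsLevelZeroRep L I cL cLI) (n m : ℤ) (x : V) :
    L n (H.wMode m x) = H.wMode m (L n x) + ((n : ℂ) - m) • H.wMode (n + m) x +
      (if n = -m then ((n : ℂ) ^ 3 - n) / 12 * (-24 * cLI ^ 2) else 0) • x := by
  have hpt : ∀ i : ℤ, L n (I i (I (m - i) x)) = I i (I (m - i) (L n x)) +
      ((-((m : ℂ) - i)) • I i (I (n + m - i) x) +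
      ((-(i : ℂ)) • I (n + i) (I (m - i) x) +
      ((if i = n + m then -(((n : ℂ) ^ 2 + n) * cLI) • I (n + m) x else 0) +
      (if i = -n then -(((n : ℂ) ^ 2 + n) * cLI) • I (n + m) x else 0)))) := by
    intro i
    rw [H.LI n i, H.LI n (m - i)]
    have h1 : n = -(m - i) ↔ i = n + m := by omega
    have h2 : n = -i ↔ i = -n := by omega
    simp only [h1, h2, map_add, map_sub, map_smul]
    have h3 : n + (m - i) = n + m - i := by ring
    rw [h3]
    have h4 : (if i = n + m then (n ^ 2 + n) * cLI else 0) • I i x =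
        -(if i = n + m then -(((n : ℂ) ^ 2 + n) * cLI) • I (n + m) x else 0) := by
      split_ifs with h
      · rw [h, neg_smul, neg_neg]
      · simp
    have h5 : (if i = -n then (n ^ 2 + n) * cLI else 0) • I (m - i) x =
        -(if i = -n then -(((n : ℂ) ^ 2 + n) * cLI) • I (n + m) x else 0) := by
      split_ifs with h
      · rw [h, neg_smul, neg_neg, sub_neg_eq_add, add_comm m n]
      · simp
    rw [h4, h5]
    push_cast
    abel
  have hshift : (fun i : ℤ => (-(i : ℂ)) • I (n + i) (I (m - i) x)) =
      (fun i : ℤ => ((n : ℂ) - i) • I i (I (n + m - i) x)) ∘ (Equiv.addLeft n) := by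
    funext i
    simp only [Function.comp_apply, Equiv.coe_addLeft]
    congr 2
    · push_cast; ring
    · congr 2; ring
  have fadd : ∀ {f g : ℤ → V}, (Function.support f).Finite → (Function.support g).Finite →
      (Function.support fun i => f i + g i).Finite := fun hf hg =>
    (hf.union hg).subset (Function.support_add _ _)
  have f1 := H.finite_quad m (L n x)
  have f2 : (Function.support fun i : ℤ =>
      (-((m : ℂ) - i)) • I i (I (n + m - i) x)).Finite :=
    (H.finite_quad (n + m) x).subset fun i hi h0 => hi (by simp only [h0, smul_zero])
  have f3' : (Function.support fun i : ℤ =>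
      ((n : ℂ) - i) • I i (I (n + m - i) x)).Finite :=
    (H.finite_quad (n + m) x).subset fun i hi h0 => hi (by simp only [h0, smul_zero])
  have f3 : (Function.support fun i : ℤ =>
      (-(i : ℂ)) • I (n + i) (I (m - i) x)).Finite := by
    rw [hshift, Function.support_comp_eq_preimage]
    exact f3'.preimage (Equiv.injective _).injOn
  have f45 : ∀ (a : ℤ) (y : V), (Function.support fun i : ℤ => if i = a then y else 0).Finite :=
    fun a y => (Set.finite_singleton a).subset fun i hi => by
      by_contra h
      exact hi (if_neg h)
  have s45 : ∀ (a : ℤ) (y : V), (∑ᶠ i : ℤ, if i = a then y else 0) = y := fun a y => by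
    rw [finsum_eq_single _ a fun i hi => if_neg hi, if_pos rfl]
  have s23 : (∑ᶠ i : ℤ, (-((m : ℂ) - i)) • I i (I (n + m - i) x)) +
      (∑ᶠ i : ℤ, (-(i : ℂ)) • I (n + i) (I (m - i) x)) =
      ((n : ℂ) - m) • ∑ᶠ i : ℤ, I i (I (n + m - i) x) := by
    have s3 : (∑ᶠ i : ℤ, (-(i : ℂ)) • I (n + i) (I (m - i) x)) =
        ∑ᶠ i : ℤ, ((n : ℂ) - i) • I i (I (n + m - i) x) := by
      rw [hshift]
      exact finsum_comp_equiv (Equiv.addLeft n)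
        (f := fun i : ℤ => ((n : ℂ) - i) • I i (I (n + m - i) x))
    rw [s3, ← finsum_add_distrib f2 f3', smul_finsum]
    refine finsum_congr fun i => ?_
    rw [← add_smul]
    congr 1
    ring
  rw [wMode_apply, wMode_apply, wMode_apply, map_sub, map_finsum' _ (H.finite_quad m x),
    finsum_congr hpt,
    finsum_add_distrib f1 (fadd f2 (fadd f3 (fadd (f45 _ _) (f45 _ _)))),
    finsum_add_distrib f2 (fadd f3 (fadd (f45 _ _) (f45 _ _))),
    finsum_add_distrib f3 (fadd (f45 _ _) (f45 _ _)),
    finsum_add_distrib (f45 _ _) (f45 _ _), s45, s45, ← add_assoc (∑ᶠ i : ℤ, _ • _), s23,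
    map_smul, H.LI n m]
  push_cast
  split_ifs with h
  · have h' : (n : ℂ) = -m := by rw [h]; push_cast; ring
    rw [h']
    module
  · module

/-- The action of the basis elements of `W(2,2)` by the operators `L n`, `W n` and by the scalars
`C = cL`, `C_W = -24 cLI²`. -/
noncomputable def w22Basis (H : IsLevelZeroRep L I cL cLI) : W22Basis → Module.End ℂ V
  | .L n => L n
  | .W n => H.wMode n
  | .C => cL • 1
  | .CW => (-24 * cLI ^ 2) • 1

theorem w22Basis_br (H : IsLevelZeroRep L I cL cLI) (i j : W22Basis) :
    Finsupp.linearCombination ℂ H.w22Basis (W22Basis.br i j) =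
      H.w22Basis i * H.w22Basis j - H.w22Basis j * H.w22Basis i := by
  have hLL (n m : ℤ) := H.LL n m
  have hLW (n m : ℤ) := H.L_wMode n m
  have hWW (n m : ℤ) := H.wMode_wMode n m
  rcases i with n | n | _ | _ <;> rcases j with m | m | _ | _ <;>
    ext x <;>
    simp only [W22Basis.br, w22Basis, map_add, map_neg, map_zero,
      Finsupp.linearCombination_single, LinearMap.add_apply, LinearMap.sub_apply,
      LinearMap.neg_apply, LinearMap.smul_apply, LinearMap.zero_apply, Module.End.mul_apply,
      Module.End.one_apply, map_smul, sub_self]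
  · rw [hLL n m x, ← ite_zero_mul]
    module
  · rw [hLW n m x, ← ite_zero_mul]
    module
  · rw [hLW m n x, ← ite_zero_mul]
    module
  · rw [hWW n m x, sub_self]
  · rw [smul_comm, sub_self]
  · rw [smul_comm, sub_self]

section Lift

attribute [local instance 100] LieRing.ofAssociativeRing

/-- The representation of `W(2,2)` on `V` by the operators `L n`, `W n`. -/
noncomputable def w22Rep (H : IsLevelZeroRep L I cL cLI) : W22 →ₗ⁅ℂ⁆ Module.End ℂ V where
  toFun x := Finsupp.linearCombination ℂ H.w22Basis x
  map_add' x y := map_add (Finsupp.linearCombination ℂ H.w22Basis) x y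
  map_smul' t x := map_smul (Finsupp.linearCombination ℂ H.w22Basis) t x
  map_lie' {x y} :=
    StructureConstants.linearCombination_bracket W22Basis.br H.w22Basis H.w22Basis_br x y

/-- The resulting action of `U(W(2,2))` on `V`. -/
noncomputable def w22Action (H : IsLevelZeroRep L I cL cLI) :
    UniversalEnvelopingAlgebra ℂ W22 →ₐ[ℂ] Module.End ℂ V :=
  UniversalEnvelopingAlgebra.lift ℂ H.w22Rep

theorem w22Action_e (H : IsLevelZeroRep L I cL cLI) (i : W22Basis) :
    H.w22Action (UniversalEnvelopingAlgebra.ι ℂ (W22.e i)) = H.w22Basis i := by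
  rw [w22Action, UniversalEnvelopingAlgebra.lift_ι_apply]
  change Finsupp.linearCombination ℂ H.w22Basis (Finsupp.single i 1) = _
  simp

end Lift

end IsLevelZeroRep

namespace HVir

/-- The universal enveloping algebra of the twisted Heisenberg-Virasoro algebra. -/
abbrev U : Type := UniversalEnvelopingAlgebra ℂ HVir

/-- The element `L n` of the enveloping algebra. -/
noncomputable def L (n : ℤ) : U := UniversalEnvelopingAlgebra.ι ℂ (e (.L n))

/-- The element `I n` of the enveloping algebra. -/
noncomputable def I (n : ℤ) : U := UniversalEnvelopingAlgebra.ι ℂ (e (.I n))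

/-- The central element `C_L`. -/
noncomputable def CL : U := UniversalEnvelopingAlgebra.ι ℂ (e .CL)

/-- The central element `C_LI`. -/
noncomputable def CLI : U := UniversalEnvelopingAlgebra.ι ℂ (e .CLI)

/-- The central element `C_I`. -/
noncomputable def CI : U := UniversalEnvelopingAlgebra.ι ℂ (e .CI)

/-- The generators of the left ideal of `U` that defines the Verma module of highest weight
`(cL, cI, cLI, h, hI)`. -/
inductive VermaRel (cL cI cLI h hI : ℂ) : U → Prop
  | L_pos (n : ℤ) (hn : 0 < n) : VermaRel cL cI cLI h hI (L n)
  | I_pos (n : ℤ) (hn : 0 < n) : VermaRel cL cI cLI h hI (I n)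
  | L_zero : VermaRel cL cI cLI h hI (L 0 - algebraMap ℂ U h)
  | I_zero : VermaRel cL cI cLI h hI (I 0 - algebraMap ℂ U hI)
  | CL : VermaRel cL cI cLI h hI (CL - algebraMap ℂ U cL)
  | CI : VermaRel cL cI cLI h hI (CI - algebraMap ℂ U cI)
  | CLI : VermaRel cL cI cLI h hI (CLI - algebraMap ℂ U cLI)

/-- The left ideal of `U` that annihilates the highest weight vector. -/
noncomputable def vermaIdeal (cL cI cLI h hI : ℂ) : Submodule U U :=
  Submodule.span U {x | VermaRel cL cI cLI h hI x}

/-- The Verma module of highest weight `(cL, cI, cLI, h, hI)` over the twisted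
Heisenberg-Virasoro algebra, a left module over `U`. -/
abbrev Verma (cL cI cLI h hI : ℂ) : Type := U ⧸ vermaIdeal cL cI cLI h hI

/-- The highest weight vector of the Verma module. -/
noncomputable def hwv (cL cI cLI h hI : ℂ) : Verma cL cI cLI h hI := Submodule.Quotient.mk 1

variable {cL cI cLI h hI : ℂ}

theorem smul_hwv (u : U) :
    u • hwv cL cI cLI h hI = Submodule.Quotient.mk u := by
  rw [hwv, ← Submodule.Quotient.mk_smul, smul_eq_mul, mul_one]

theorem smul_hwv_eq_zero {u : U} (hu : VermaRel cL cI cLI h hI u) :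
    u • hwv cL cI cLI h hI = 0 := by
  rw [smul_hwv]
  exact (Submodule.Quotient.mk_eq_zero _).2 (Submodule.subset_span hu)

theorem smul_hwv_eq_smul {u : U} {a : ℂ} (hu : VermaRel cL cI cLI h hI (u - algebraMap ℂ U a)) :
    u • hwv cL cI cLI h hI = a • hwv cL cI cLI h hI := by
  have := smul_hwv_eq_zero hu
  rwa [sub_smul, sub_eq_zero, algebraMap_smul] at this

/-- Induction on the vectors of a Verma module. -/
theorem verma_induction {P : Verma cL cI cLI h hI → Prop} (hv : P (hwv cL cI cLI h hI))
    (hadd : ∀ x y, P x → P y → P (x + y)) (hsmul : ∀ (t : ℂ) x, P x → P (t • x))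
    (hg : ∀ (i : HVirBasis) x, P x → P (UniversalEnvelopingAlgebra.ι ℂ (e i) • x))
    (x : Verma cL cI cLI h hI) : P x := by
  have h0 : P 0 := by simpa using hsmul 0 _ hv
  let S : Subalgebra ℂ U :=
    { carrier := {u | ∀ x, P x → P (u • x)}
      mul_mem' := fun {a b} ha hb x hx => by
        rw [mul_smul]; exact ha _ (hb _ hx)
      add_mem' := fun {a b} ha hb x hx => by
        rw [add_smul]; exact hadd _ _ (ha _ hx) (hb _ hx)
      algebraMap_mem' := fun t x hx => by
        rw [algebraMap_smul]; exact hsmul t _ hx }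
  have hS : ∀ y : HVir, UniversalEnvelopingAlgebra.ι ℂ y ∈ S := by
    intro y
    induction y using Finsupp.induction_linear with
    | zero =>
      have : UniversalEnvelopingAlgebra.ι ℂ (0 : HVir) ∈ S := by
        rw [map_zero]; exact S.zero_mem
      exact this
    | add y z hy hz =>
      have : UniversalEnvelopingAlgebra.ι ℂ ((id y : HVir) + (id z : HVir)) ∈ S := by
        rw [map_add]; exact S.add_mem hy hz
      exact this
    | single i t =>
      have h1 : (Finsupp.single i t : HVirBasis →₀ ℂ) = (t • e i : HVir) :=
        (Finsupp.smul_single_one i t).symm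
      have : UniversalEnvelopingAlgebra.ι ℂ (t • e i) ∈ S := by
        rw [map_smul]; exact S.smul_mem (fun x hx => hg i x hx) t
      rw [h1]
      exact this
  induction x using Submodule.Quotient.induction_on with
  | H u =>
    rw [← smul_hwv]
    exact UniversalEnvelopingAlgebra.induction_of_generators S hS u _ hv

theorem ι_smul_ι_smul (i j : HVirBasis) (x : Verma cL cI cLI h hI) :
    UniversalEnvelopingAlgebra.ι ℂ (e i) • UniversalEnvelopingAlgebra.ι ℂ (e j) • x =
      UniversalEnvelopingAlgebra.ι ℂ (e j) • UniversalEnvelopingAlgebra.ι ℂ (e i) • x +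
        UniversalEnvelopingAlgebra.ι ℂ (⁅e i, e j⁆ : HVir) • x := by
  rw [UniversalEnvelopingAlgebra.ι_lie, sub_smul, mul_smul, mul_smul]
  abel

theorem ι_central_smul (c : HVirBasis) (hc : ∀ i, ⁅e c, e i⁆ = (0 : HVir)) (a : ℂ)
    (ha : VermaRel cL cI cLI h hI (UniversalEnvelopingAlgebra.ι ℂ (e c) - algebraMap ℂ U a))
    (x : Verma cL cI cLI h hI) : UniversalEnvelopingAlgebra.ι ℂ (e c) • x = a • x := by
  induction x using verma_induction with
  | hv => exact smul_hwv_eq_smul ha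
  | hadd x y hx hy => rw [smul_add, smul_add, hx, hy]
  | hsmul t x hx => rw [smul_comm, hx, smul_comm]
  | hg i x hx => rw [ι_smul_ι_smul, hx, hc, map_zero, zero_smul, add_zero, smul_comm]

theorem CL_smul (x : Verma cL cI cLI h hI) : CL • x = cL • x :=
  ι_central_smul .CL (fun i => by rw [lie_e]; cases i <;> rfl) cL .CL x

theorem CLI_smul (x : Verma cL cI cLI h hI) : CLI • x = cLI • x :=
  ι_central_smul .CLI (fun i => by rw [lie_e]; cases i <;> rfl) cLI .CLI x

theorem CI_smul (x : Verma cL cI cLI h hI) : CI • x = cI • x :=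
  ι_central_smul .CI (fun i => by rw [lie_e]; cases i <;> rfl) cI .CI x

theorem single_eq (i : HVirBasis) (t : ℂ) :
    (Finsupp.single i t : HVirBasis →₀ ℂ) = (t • e i : HVir) :=
  (Finsupp.smul_single_one i t).symm

theorem lie_LL (n m : ℤ) : ⁅e (.L n), e (.L m)⁆ = ((n : ℂ) - m) • e (.L (n + m)) +
    (if n = -m then ((n : ℂ) ^ 3 - n) / 12 else 0) • e .CL := by
  rw [lie_e]
  simp only [HVirBasis.br, single_eq]
  rfl

theorem lie_LI (n m : ℤ) : ⁅e (.L n), e (.I m)⁆ = (-(m : ℂ)) • e (.I (n + m)) -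
    (if n = -m then (n : ℂ) ^ 2 + n else 0) • e .CLI := by
  rw [lie_e]
  simp only [HVirBasis.br, single_eq]
  rfl

theorem lie_II (n m : ℤ) : ⁅e (.I n), e (.I m)⁆ = (if n = -m then (n : ℂ) else 0) • e .CI := by
  rw [lie_e]
  simp only [HVirBasis.br, single_eq]

theorem L_smul_L_smul (n m : ℤ) (x : Verma cL cI cLI h hI) : L n • L m • x =
    L m • L n • x + ((n : ℂ) - m) • L (n + m) • x +
      (if n = -m then ((n : ℂ) ^ 3 - n) / 12 * cL else 0) • x := by
  have := ι_smul_ι_smul (.L n) (.L m) x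
  rw [lie_LL, map_add, map_smul, map_smul, add_smul, smul_assoc, smul_assoc] at this
  refine this.trans ?_
  change _ + (_ + _ • CL • x) = _
  rw [CL_smul, smul_smul (if n = -m then _ else _) cL x, ite_zero_mul, ← add_assoc]
  rfl

theorem L_smul_I_smul (n m : ℤ) (x : Verma cL cI cLI h hI) : L n • I m • x =
    I m • L n • x + (-(m : ℂ)) • I (n + m) • x -
      (if n = -m then ((n : ℂ) ^ 2 + n) * cLI else 0) • x := by
  have := ι_smul_ι_smul (.L n) (.I m) x
  rw [lie_LI, map_sub, map_smul, map_smul, sub_smul, smul_assoc, smul_assoc] at this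
  refine this.trans ?_
  change _ + (_ - _ • CLI • x) = _
  rw [CLI_smul, smul_smul (if n = -m then _ else _) cLI x, ite_zero_mul, ← add_sub_assoc]
  rfl

theorem I_smul_I_smul (n m : ℤ) (x : Verma cL 0 cLI h hI) : I n • I m • x = I m • I n • x := by
  have := ι_smul_ι_smul (.I n) (.I m) x
  rw [lie_II, map_smul, smul_assoc] at this
  refine this.trans ?_
  change _ + _ • CI • x = _
  rw [CI_smul, zero_smul, smul_zero, add_zero]
  rfl

/-- The operator `L n` on the Verma module. -/
noncomputable def opL (cL cI cLI h hI : ℂ) (n : ℤ) : Module.End ℂ (Verma cL cI cLI h hI) :=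
  Algebra.lsmul ℂ ℂ _ (L n)

/-- The operator `I n` on the Verma module. -/
noncomputable def opI (cL cI cLI h hI : ℂ) (n : ℤ) : Module.End ℂ (Verma cL cI cLI h hI) :=
  Algebra.lsmul ℂ ℂ _ (I n)

theorem I_smooth (x : Verma cL 0 cLI h hI) : ∃ N : ℤ, ∀ n : ℤ, N ≤ n → I n • x = 0 := by
  induction x using verma_induction with
  | hv => exact ⟨1, fun n hn => smul_hwv_eq_zero (.I_pos n (by omega))⟩
  | hadd x y hx hy =>
    obtain ⟨N, hN⟩ := hx
    obtain ⟨M, hM⟩ := hy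
    refine ⟨max N M, fun n hn => ?_⟩
    rw [smul_add, hN n (le_trans (le_max_left _ _) hn), hM n (le_trans (le_max_right _ _) hn),
      add_zero]
  | hsmul t x hx =>
    obtain ⟨N, hN⟩ := hx
    exact ⟨N, fun n hn => by rw [smul_comm, hN n hn, smul_zero]⟩
  | hg i x hx =>
    obtain ⟨N, hN⟩ := hx
    rcases i with m | m | _ | _ | _
    · refine ⟨max N (max (N - m) (1 - m)), fun n hn => ?_⟩
      have h1 : N ≤ n := le_trans (le_max_left _ _) hn
      have h2 : N - m ≤ n := le_trans (le_max_left _ _) (le_trans (le_max_right _ _) hn)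
      have h3 : 1 - m ≤ n := le_trans (le_max_right _ _) (le_trans (le_max_right _ _) hn)
      have := L_smul_I_smul m n x
      rw [hN n h1, hN (m + n) (by omega), if_neg (by omega), smul_zero, smul_zero, zero_smul,
        add_zero, sub_zero] at this
      exact this.symm
    · refine ⟨N, fun n hn => ?_⟩
      change I n • I m • x = 0
      rw [I_smul_I_smul, hN n hn, smul_zero]
    · refine ⟨N, fun n hn => ?_⟩
      change I n • CL • x = 0
      rw [CL_smul, smul_comm, hN n hn, smul_zero]
    · refine ⟨N, fun n hn => ?_⟩
      change I n • CLI • x = 0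
      rw [CLI_smul, smul_comm, hN n hn, smul_zero]
    · refine ⟨N, fun n hn => ?_⟩
      change I n • CI • x = 0
      rw [CI_smul, smul_comm, hN n hn, smul_zero]

theorem isLevelZeroRep (cL cLI h hI : ℂ) :
    IsLevelZeroRep (opL cL 0 cLI h hI) (opI cL 0 cLI h hI) cL cLI where
  LL n m x := L_smul_L_smul n m x
  LI n m x := L_smul_I_smul n m x
  II n m x := I_smul_I_smul n m x
  smooth x := I_smooth x

/-- The operator `W n` on the level zero Verma module of the twisted Heisenberg-Virasoro
algebra. -/
noncomputable def opW (cL cLI h hI : ℂ) (n : ℤ) : Module.End ℂ (Verma cL 0 cLI h hI) :=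
  (isLevelZeroRep cL cLI h hI).wMode n

theorem opW_hwv_pos (n : ℤ) (hn : 0 < n) : opW cL cLI h hI n (hwv cL 0 cLI h hI) = 0 := by
  have hI' : ∀ k : ℤ, 0 < k → opI cL 0 cLI h hI k (hwv cL 0 cLI h hI) = 0 := fun k hk =>
    smul_hwv_eq_zero (.I_pos k hk)
  rw [opW, IsLevelZeroRep.wMode_apply, hI' n hn, smul_zero, sub_zero,
    finsum_eq_zero_of_forall_eq_zero]
  intro i
  by_cases hi : 0 < i
  · rw [(isLevelZeroRep cL cLI h hI).II, hI' i hi, map_zero]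
  · rw [hI' (n - i) (by omega), map_zero]

theorem opW_hwv_zero : opW cL cLI h hI 0 (hwv cL 0 cLI h hI) =
    (hI * (hI - 2 * cLI)) • hwv cL 0 cLI h hI := by
  have hI' : ∀ k : ℤ, 0 < k → opI cL 0 cLI h hI k (hwv cL 0 cLI h hI) = 0 := fun k hk =>
    smul_hwv_eq_zero (.I_pos k hk)
  have hI0 : opI cL 0 cLI h hI 0 (hwv cL 0 cLI h hI) = hI • hwv cL 0 cLI h hI :=
    smul_hwv_eq_smul .I_zero
  rw [opW, IsLevelZeroRep.wMode_apply, finsum_eq_single _ 0, sub_zero, hI0, map_smul, hI0]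
  · simp only [Int.cast_zero]
    module
  · intro i hi
    rcases lt_or_gt_of_ne hi with h0 | h0
    · rw [hI' (0 - i) (by omega), map_zero]
    · rw [(isLevelZeroRep cL cLI h hI).II, hI' i h0, map_zero]

end HVir

namespace W22

/-- The universal enveloping algebra of `W(2,2)`. -/
abbrev U : Type := UniversalEnvelopingAlgebra ℂ W22

/-- The element `L n` of the enveloping algebra. -/
noncomputable def L (n : ℤ) : U := UniversalEnvelopingAlgebra.ι ℂ (e (.L n))

/-- The element `W n` of the enveloping algebra. -/
noncomputable def W (n : ℤ) : U := UniversalEnvelopingAlgebra.ι ℂ (e (.W n))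

/-- The central element `C`. -/
noncomputable def C : U := UniversalEnvelopingAlgebra.ι ℂ (e .C)

/-- The central element `C_W`. -/
noncomputable def CW : U := UniversalEnvelopingAlgebra.ι ℂ (e .CW)

/-- The generators of the left ideal of `U` that defines the Verma module of central charge
`(cL, cW)` and highest weight `(h, hW)`. -/
inductive VermaRel (cL cW h hW : ℂ) : U → Prop
  | L_pos (n : ℤ) (hn : 0 < n) : VermaRel cL cW h hW (L n)
  | W_pos (n : ℤ) (hn : 0 < n) : VermaRel cL cW h hW (W n)
  | L_zero : VermaRel cL cW h hW (L 0 - algebraMap ℂ U h)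
  | W_zero : VermaRel cL cW h hW (W 0 - algebraMap ℂ U hW)
  | C : VermaRel cL cW h hW (C - algebraMap ℂ U cL)
  | CW : VermaRel cL cW h hW (CW - algebraMap ℂ U cW)

/-- The left ideal of `U` that annihilates the highest weight vector. -/
noncomputable def vermaIdeal (cL cW h hW : ℂ) : Submodule U U :=
  Submodule.span U {x | VermaRel cL cW h hW x}

/-- The Verma module of central charge `(cL, cW)` and highest weight `(h, hW)` over `W(2,2)`,
a left module over `U`. -/
abbrev Verma (cL cW h hW : ℂ) : Type := U ⧸ vermaIdeal cL cW h hW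

/-- The highest weight vector of the Verma module. -/
noncomputable def hwv (cL cW h hW : ℂ) : Verma cL cW h hW := Submodule.Quotient.mk 1

/-- `u` is a singular vector of conformal weight `p`: a nonzero vector that is annihilated by
all `L n`, `W n` with `n > 0` and is an eigenvector of `L 0`, with eigenvalue `h + p`, and
of `W 0`. -/
structure IsSingularVector {cL cW h hW : ℂ} (u : Verma cL cW h hW) (p : ℕ) : Prop where
  ne_zero : u ≠ 0
  L_pos : ∀ n : ℤ, 0 < n → L n • u = 0
  W_pos : ∀ n : ℤ, 0 < n → W n • u = 0
  L_zero : L 0 • u = (h + p) • u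
  W_zero : ∃ a : ℂ, W 0 • u = a • u

end W22

section Psi

variable {cL cW cLI h hW hI : ℂ}

/-- The action of `U(W(2,2))` on the level zero Verma module of the twisted Heisenberg-Virasoro
algebra: `L n` acts by `L n`, `W n` by `opW n`, `C` by `cL` and `C_W` by `-24 cLI²`. -/
noncomputable def w22Action (cL cLI h hI : ℂ) :
    W22.U →ₐ[ℂ] Module.End ℂ (HVir.Verma cL 0 cLI h hI) :=
  (HVir.isLevelZeroRep cL cLI h hI).w22Action

theorem w22Action_L (n : ℤ) : w22Action cL cLI h hI (W22.L n) = HVir.opL cL 0 cLI h hI n :=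
  IsLevelZeroRep.w22Action_e _ _

theorem w22Action_W (n : ℤ) : w22Action cL cLI h hI (W22.W n) = HVir.opW cL cLI h hI n :=
  IsLevelZeroRep.w22Action_e _ _

theorem w22Action_C : w22Action cL cLI h hI W22.C = cL • 1 :=
  IsLevelZeroRep.w22Action_e _ _

theorem w22Action_CW : w22Action cL cLI h hI W22.CW = (-24 * cLI ^ 2) • 1 :=
  IsLevelZeroRep.w22Action_e _ _

/-- The map `u ↦ u v` from `U(W(2,2))` to the level zero Verma module of the twisted
Heisenberg-Virasoro algebra, where `v` is the highest weight vector. -/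
noncomputable def w22Orbit (cL cLI h hI : ℂ) : W22.U →ₗ[ℂ] HVir.Verma cL 0 cLI h hI :=
  (LinearMap.applyₗ (HVir.hwv cL 0 cLI h hI)).comp (w22Action cL cLI h hI).toLinearMap

theorem w22Orbit_apply (u : W22.U) :
    w22Orbit cL cLI h hI u = w22Action cL cLI h hI u (HVir.hwv cL 0 cLI h hI) := rfl

theorem vermaIdeal_le_ker (hcW : cW = -24 * cLI ^ 2) (hhW : hW = hI * (hI - 2 * cLI)) :
    (W22.vermaIdeal cL cW h hW).restrictScalars ℂ ≤ LinearMap.ker (w22Orbit cL cLI h hI) := by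
  intro u hu
  rw [LinearMap.mem_ker, w22Orbit_apply]
  rw [Submodule.restrictScalars_mem] at hu
  induction hu using Submodule.span_induction with
  | mem x hx =>
    cases hx with
    | L_pos n hn => rw [w22Action_L]; exact HVir.smul_hwv_eq_zero (.L_pos n hn)
    | W_pos n hn => rw [w22Action_W]; exact HVir.opW_hwv_pos n hn
    | L_zero =>
      rw [map_sub, w22Action_L, AlgHom.commutes, LinearMap.sub_apply, sub_eq_zero]
      exact HVir.smul_hwv_eq_smul .L_zero
    | W_zero =>
      rw [map_sub, w22Action_W, AlgHom.commutes, LinearMap.sub_apply, HVir.opW_hwv_zero, hhW,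
        sub_eq_zero]
      rfl
    | C =>
      rw [map_sub, w22Action_C, AlgHom.commutes, LinearMap.sub_apply, sub_eq_zero]
      rfl
    | CW =>
      rw [map_sub, w22Action_CW, AlgHom.commutes, LinearMap.sub_apply, hcW, sub_eq_zero]
      rfl
  | zero => simp
  | add x y _ _ hx hy => rw [map_add, LinearMap.add_apply, hx, hy, add_zero]
  | smul a x _ hx => rw [smul_eq_mul, map_mul, Module.End.mul_apply, hx, map_zero]

/-- The homomorphism `Ψ` of `W(2,2)`-modules from the Verma module of `W(2,2)` to the level zero
Verma module of the twisted Heisenberg-Virasoro algebra that sends the class of `u` to `u v`; in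
particular it sends the highest weight vector to the highest weight vector. -/
noncomputable def Psi (hcW : cW = -24 * cLI ^ 2) (hhW : hW = hI * (hI - 2 * cLI)) :
    W22.Verma cL cW h hW →ₗ[ℂ] HVir.Verma cL 0 cLI h hI :=
  (((W22.vermaIdeal cL cW h hW).restrictScalars ℂ).liftQ (w22Orbit cL cLI h hI)
    (vermaIdeal_le_ker hcW hhW)).comp
      (Submodule.Quotient.restrictScalarsEquiv ℂ (W22.vermaIdeal cL cW h hW)).symm.toLinearMap

theorem Psi_mk (hcW : cW = -24 * cLI ^ 2) (hhW : hW = hI * (hI - 2 * cLI)) (u : W22.U) :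
    Psi (cL := cL) (h := h) hcW hhW (Submodule.Quotient.mk u) =
      w22Action cL cLI h hI u (HVir.hwv cL 0 cLI h hI) := rfl

theorem Psi_hwv (hcW : cW = -24 * cLI ^ 2) (hhW : hW = hI * (hI - 2 * cLI)) :
    Psi hcW hhW (W22.hwv cL cW h hW) = HVir.hwv cL 0 cLI h hI := by
  rw [W22.hwv, Psi_mk, map_one, Module.End.one_apply]

theorem Psi_smul (hcW : cW = -24 * cLI ^ 2) (hhW : hW = hI * (hI - 2 * cLI)) (u : W22.U)
    (x : W22.Verma cL cW h hW) :
    Psi hcW hhW (u • x) = w22Action cL cLI h hI u (Psi hcW hhW x) := by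
  induction x using Submodule.Quotient.induction_on with
  | H y =>
    rw [← Submodule.Quotient.mk_smul, smul_eq_mul, Psi_mk, Psi_mk, map_mul, Module.End.mul_apply]

end Psi

/-- The power series `∑_{n ≥ 1} (x n / n) y ^ n` in `y`, where the variable `X n` stands for
`x n`; the variable `X 0` does not occur. -/
noncomputable def schurExponent : PowerSeries (MvPolynomial ℕ ℂ) :=
  PowerSeries.mk fun n : ℕ =>
    if n = 0 then 0 else MvPolynomial.C (1 / (n : ℂ)) * MvPolynomial.X n

theorem hasSubst_schurExponent : PowerSeries.HasSubst schurExponent :=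
  PowerSeries.HasSubst.of_constantCoeff_zero' (by
    rw [← PowerSeries.coeff_zero_eq_constantCoeff_apply, schurExponent, PowerSeries.coeff_mk,
      if_pos rfl])

/-- The Schur polynomials `S r (x 1, x 2, …)`, with generating function
`exp (∑_{n ≥ 1} (x n / n) y ^ n) = ∑_{r ≥ 0} S r (x 1, x 2, …) y ^ r`. -/
noncomputable def schurPoly (r : ℕ) : MvPolynomial ℕ ℂ :=
  PowerSeries.coeff r ((PowerSeries.exp (MvPolynomial ℕ ℂ)).subst schurExponent)

open scoped IsMulCommutative in
/-- Evaluation of polynomials at a family of pairwise commuting elements of an algebra. -/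
noncomputable def evalCommuting {A : Type*} [Ring A] [Algebra ℂ A] (a : ℕ → A)
    (ha : ∀ i j, a i * a j = a j * a i) : MvPolynomial ℕ ℂ →ₐ[ℂ] A :=
  haveI : IsMulCommutative (Algebra.adjoin ℂ (Set.range a)) :=
    Algebra.isMulCommutative_adjoin ℂ (by rintro _ ⟨i, rfl⟩ _ ⟨j, rfl⟩; exact ha i j)
  (Algebra.adjoin ℂ (Set.range a)).val.comp
    (MvPolynomial.aeval fun i => ⟨a i, Algebra.subset_adjoin ⟨i, rfl⟩⟩)

theorem evalCommuting_X {A : Type*} [Ring A] [Algebra ℂ A] (a : ℕ → A)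
    (ha : ∀ i j, a i * a j = a j * a i) (i : ℕ) :
    evalCommuting a ha (MvPolynomial.X i) = a i := by
  simp [evalCommuting]

theorem HVir.I_neg_commute (i j : ℕ) :
    I (-(i : ℤ)) * I (-(j : ℤ)) = I (-(j : ℤ)) * I (-(i : ℤ)) := by
  have h : (⁅e (.I (-(i : ℤ))), e (.I (-(j : ℤ)))⁆ : HVir) = 0 := by
    rw [lie_II]
    split_ifs with hij
    · have : i = 0 := by omega
      subst this
      simp
    · exact zero_smul _ _
  have h' := congrArg (UniversalEnvelopingAlgebra.ι ℂ) h
  rw [UniversalEnvelopingAlgebra.ι_lie, map_zero, sub_eq_zero] at h'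
  exact h'

/-- The vector `S p (-I(-1)/cLI, -I(-2)/cLI, …) v` of the Verma module of the twisted
Heisenberg-Virasoro algebra, `v` being the highest weight vector. -/
noncomputable def schurVector (cL cI cLI h hI : ℂ) (p : ℕ) : HVir.Verma cL cI cLI h hI :=
  evalCommuting (fun n : ℕ => -((1 / cLI) • HVir.I (-(n : ℤ))))
    (fun i j => by
      simp only [neg_mul_neg, smul_mul_assoc, mul_smul_comm, HVir.I_neg_commute i j])
    (schurPoly p) • HVir.hwv cL cI cLI h hI

/-! Free fields realise everything. Take two currents `current z true` and `current z false`, each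
isotropic and paired only with the other. The modes of the first represent I(n), isotropy giving C_I
= 0. The L(n) come from the normally ordered product of the two currents plus background charges.
This maps the Verma module over the twisted Heisenberg-Virasoro algebra to a polynomial ring whose
size is known, so linear independence can be read off there.

Injectivity of Ψ (`Psi_injective`): on a vector where the modes I(k), k ≥ 0, act as on the highest
weight vector, W(-m-1) equals 2(h_I + m c_LI) I(-m-1) plus products of I(-j-1) with j < m. Here the
coefficient is 2 c_LI (p + 1 + m) ≠ 0, so every polynomial in the negative modes of I applied to the
highest weight vector lies in the range of Ψ (`I_smul_mem_range_Psi`). The L(-n) then generate the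
rest of the Fock space (`Fock.eq_top_of_vir_mem`), so the composite of Ψ with the map to the Fock
space is onto. Ordered words in the L(-n), W(-n) span the W(2,2) Verma module and are indexed, with
weights, by the monomials of the Fock space. A graded surjection between finite-dimensional pieces
of equal size is injective. Only the spanning half of Poincaré-Birkhoff-Witt is used.

The Schur vector therefore has a unique preimage, and singularity can be checked in the image. For
I-highest vectors the claims on W(n), n ≥ 0, are immediate. For L(n), n > 0, put S(y) = exp(-∑ I(-k)
y^k / (k c_LI)). Commuting L(n) through it gives L(n) S(y) v = y^n (y d/dy + n - p) S(y) v, so L(n)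
S_r v = (r - p) S_{r-n} v, which vanishes at r = p (`HVir.L_smul_schurVector`). -/

/-! ### Two paired currents on the Fock space and their normally ordered product -/

/-- The polynomial Fock space of two free bosonic currents; the variable `(s, m)` is the mode
`-(m + 1)` of the current `s`. -/
abbrev Fock : Type := MvPolynomial (Bool × ℕ) ℂ

namespace Fock

open MvPolynomial

theorem pderiv_comm (i j : Bool × ℕ) (f : Fock) :
    pderiv i (pderiv j f) = pderiv j (pderiv i f) := by
  have h : ⁅pderiv (R := ℂ) i, pderiv (R := ℂ) j⁆ = 0 := by
    refine MvPolynomial.derivation_ext fun k => ?_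
    classical
    simp only [Derivation.commutator_apply, pderiv_X, Derivation.zero_apply, Pi.single_apply]
    split_ifs <;> simp
  have h' := congrArg (fun D => D f) h
  simpa only [Derivation.commutator_apply, Derivation.zero_apply, sub_eq_zero] using h'

theorem eq_C_of_pderiv_eq_zero (g : Fock) (hg : ∀ i, pderiv i g = 0) :
    g = C (constantCoeff g) := by
  classical
  ext a
  rw [coeff_C]
  split_ifs with h
  · rw [← h, constantCoeff_eq]
  · obtain ⟨i, hi⟩ : ∃ i, a i ≠ 0 := by
      by_contra! h0
      exact h (Finsupp.ext h0).symm
    have h1 := congrArg (coeff (a - Finsupp.single i 1)) (hg i)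
    have h2 : a - Finsupp.single i 1 + Finsupp.single i 1 = a :=
      tsub_add_cancel_of_le (Finsupp.single_le_iff.2 (Nat.one_le_iff_ne_zero.2 hi))
    rw [coeff_pderiv, h2, coeff_zero, mul_eq_zero] at h1
    rcases h1 with h1 | h1
    · exact h1
    · exact absurd h1 (Nat.cast_add_one_ne_zero _)

/-- The mode `n` of the current `s` on the Fock space, with zero mode `z s`. -/
noncomputable def current (z : Bool → ℂ) (s : Bool) : ℤ → Module.End ℂ Fock
  | .negSucc m => LinearMap.mulLeft ℂ (X (s, m))
  | .ofNat 0 => z s • 1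
  | .ofNat (m + 1) => ((m : ℂ) + 1) • (pderiv (!s, m)).toLinearMap

variable (z : Bool → ℂ)

theorem current_neg (s : Bool) (m : ℕ) (f : Fock) :
    current z s (-((m : ℤ) + 1)) f = X (s, m) * f := by
  rw [← Int.negSucc_eq]
  rfl

theorem current_zero (s : Bool) (f : Fock) : current z s 0 f = z s • f := rfl

theorem current_pos (s : Bool) (m : ℕ) (f : Fock) :
    current z s ((m : ℤ) + 1) f = ((m : ℂ) + 1) • pderiv (!s, m) f := rfl

theorem int_cases (n : ℤ) : (∃ m : ℕ, n = -((m : ℤ) + 1)) ∨ n = 0 ∨ ∃ m : ℕ, n = (m : ℤ) + 1 := by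
  rcases lt_trichotomy n 0 with h | h | h
  · exact .inl ⟨(-n - 1).toNat, by omega⟩
  · exact .inr (.inl h)
  · exact .inr (.inr ⟨(n - 1).toNat, by omega⟩)

theorem current_comm (s t : Bool) (n m : ℤ) (f : Fock) :
    current z s n (current z t m f) = current z t m (current z s n f) +
      (if s = !t ∧ n = -m then (n : ℂ) else 0) • f := by
  classical
  have hX (s t : Bool) (a b : ℕ) (g : Fock) : pderiv (!s, a) (X (t, b) * g) =
      X (t, b) * pderiv (!s, a) g + if s = !t ∧ a = b then g else 0 := by
    rw [pderiv_mul, pderiv_X, Pi.single_apply, add_comm]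
    congr 1
    simp only [Prod.mk.injEq]
    cases s <;> cases t <;> grind
  rcases int_cases n with ⟨a, rfl⟩ | rfl | ⟨a, rfl⟩ <;>
  rcases int_cases m with ⟨b, rfl⟩ | rfl | ⟨b, rfl⟩
  · rw [if_neg (by omega), zero_smul, add_zero]
    simp only [current_neg]
    ring
  · rw [if_neg (by omega), zero_smul, add_zero, current_zero, current_zero, map_smul]
  · rw [current_pos, current_pos, current_neg, current_neg, hX, smul_add, mul_smul_comm, add_assoc,
      left_eq_add]
    by_cases h : t = !s ∧ b = a
    · obtain ⟨rfl, rfl⟩ := h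
      simp only [Bool.not_not, and_self, if_true]
      push_cast
      module
    · rw [if_neg h, if_neg (by cases s <;> cases t <;> grind)]
      simp
  · rw [if_neg (by omega), zero_smul, add_zero, current_zero, current_zero, map_smul]
  · rw [current_zero, current_zero, current_zero, current_zero, smul_comm]
    simp
  · rw [if_neg (by omega), zero_smul, add_zero, current_zero, current_zero, map_smul]
  · rw [current_pos, current_pos, current_neg, current_neg, hX, smul_add, mul_smul_comm]
    congr 1
    by_cases h : s = !t ∧ a = b
    · obtain ⟨rfl, rfl⟩ := h
      simp
    · rw [if_neg h, if_neg (by grind)]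
      simp
  · rw [if_neg (by omega), zero_smul, add_zero, current_zero, current_zero, map_smul]
  · rw [if_neg (by omega), zero_smul, add_zero, current_pos, current_pos, current_pos, current_pos,
      Derivation.map_smul, Derivation.map_smul, pderiv_comm (!s, a), smul_comm]

theorem current_smooth (f : Fock) :
    ∃ N : ℤ, 0 ≤ N ∧ ∀ n : ℤ, N ≤ n → ∀ s, current z s n f = 0 := by
  -- The mode m + 1 differentiates in a variable of index m; the 2 accounts for this shift and for
  -- strict inequality.
  refine ⟨(f.vars.sup Prod.snd : ℕ) + 2, by omega, fun n hn s => ?_⟩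
  obtain ⟨m, rfl⟩ : ∃ m : ℕ, n = (m : ℤ) + 1 := ⟨(n - 1).toNat, by omega⟩
  rw [current_pos, pderiv_eq_zero_of_notMem_vars, smul_zero]
  intro h
  have := Finset.le_sup (f := Prod.snd) h
  simp only at this
  omega

theorem current_one (s : Bool) (n : ℤ) (hn : 0 < n) : current z s n 1 = 0 := by
  obtain ⟨m, rfl⟩ : ∃ m : ℕ, n = (m : ℤ) + 1 := ⟨(n - 1).toNat, by omega⟩
  rw [current_pos, pderiv_one, smul_zero]

/-- An endomorphism that commutes with all modes of the currents is a scalar. -/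
theorem eq_smul_of_commute (T : Module.End ℂ Fock)
    (hT : ∀ s n f, T (current z s n f) = current z s n (T f)) :
    ∀ f, T f = constantCoeff (T 1) • f := by
  -- Commuting with the creation modes makes `T` multiplication by `T 1`; commuting with the
  -- annihilation modes kills all derivatives of `T 1`, so it is constant.
  have h1 : ∀ f, T f = f * T 1 := by
    intro f
    induction f using MvPolynomial.induction_on with
    | C a =>
      rw [← mul_one (C a), ← smul_eq_C_mul, map_smul, smul_mul_assoc, one_mul]
    | add f g hf hg => rw [map_add, hf, hg, add_mul]
    | mul_X f i hf =>
      rw [mul_comm f, ← current_neg z i.1 i.2, hT, current_neg, current_neg, hf, mul_assoc]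
  have h2 : T 1 = C (constantCoeff (T 1)) := by
    refine eq_C_of_pderiv_eq_zero _ fun i => ?_
    have h3 := hT (!i.1) ((i.2 : ℤ) + 1) 1
    rw [current_one _ _ _ (by omega), map_zero, current_pos, Bool.not_not, eq_comm,
      smul_eq_zero] at h3
    exact h3.resolve_left (Nat.cast_add_one_ne_zero _)
  intro f
  rw [h1 f]
  nth_rewrite 1 [h2]
  rw [mul_comm, smul_eq_C_mul]

/-- The term `:J true k J false (n - k):` of the mode `n` of the normally ordered product of the
two currents. -/
noncomputable def normalProd (n k : ℤ) (f : Fock) : Fock :=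
  if k < 0 then current z true k (current z false (n - k) f)
  else current z false (n - k) (current z true k f)

theorem normalProd_add (n k : ℤ) (f g : Fock) :
    normalProd z n k (f + g) = normalProd z n k f + normalProd z n k g := by
  unfold normalProd
  split_ifs <;> simp only [map_add]

theorem normalProd_smul (n k : ℤ) (t : ℂ) (f : Fock) :
    normalProd z n k (t • f) = t • normalProd z n k f := by
  unfold normalProd
  split_ifs <;> simp only [map_smul]

theorem finite_normalProd (n : ℤ) (f : Fock) :
    (Function.support fun k => normalProd z n k f).Finite := by
  obtain ⟨N, hN0, hN⟩ := current_smooth z f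
  -- The factor acting first is `current z false (n - k)` for k < 0, which vanishes once k ≤ n - N,
  -- and `current z true k` for k ≥ 0, which vanishes once k ≥ N.
  refine (Set.finite_Ioo (min (n - N) (-1)) N).subset fun k hk => ?_
  rw [Function.mem_support, normalProd] at hk
  rw [Set.mem_Ioo, min_lt_iff]
  split_ifs at hk with h
  · refine ⟨.inl ?_, by omega⟩
    by_contra h1
    exact hk (by rw [hN (n - k) (by omega), map_zero])
  · refine ⟨.inr (by omega), ?_⟩
    by_contra h1
    exact hk (by rw [hN k (by omega), map_zero])

/-- A current contracts only with the factor of opposite type, and only for the one k at which the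
modes cancel. The surviving factor is then the mode n + m of the original current. -/
theorem normalProd_current (n k m : ℤ) (s : Bool) (f : Fock) :
    normalProd z n k (current z s m f) = current z s m (normalProd z n k f) +
      if k = (if s then n + m else -m) then -(m : ℂ) • current z s (n + m) f else 0 := by
  have ht := current_comm z true s k m
  have hf := current_comm z false s (n - k) m
  unfold normalProd
  cases s
  · simp only [Bool.not_false, true_and, Bool.false_eq_true, false_and, if_false,
      zero_smul, add_zero] at ht hf ⊢
    split_ifs at ht ⊢ with h1 h2 h2
    · subst h2
      rw [hf, ht, sub_neg_eq_add]
      push_cast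
      rfl
    · rw [hf, ht, zero_smul, add_zero]
    · subst h2
      rw [ht, map_add, hf, map_smul, sub_neg_eq_add]
      push_cast
      rfl
    · rw [ht, zero_smul, add_zero, hf, add_zero]
  · simp only [Bool.not_true, Bool.true_eq_false, false_and, if_false, true_and, if_true,
      zero_smul, add_zero] at ht hf ⊢
    have h3 : n - k = -m ↔ k = n + m := by omega
    simp only [h3] at hf
    split_ifs at hf ⊢ with h1 h2 h2
    · subst h2
      rw [hf, map_add, ht, map_smul]
      push_cast
      congr 2
      ring
    · rw [hf, zero_smul, add_zero, ht, add_zero]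
    · subst h2
      rw [ht, hf]
      push_cast
      congr 2
      ring
    · rw [ht, hf, zero_smul, add_zero]

/-- The mode `n` of the normally ordered product of the two currents. -/
noncomputable def quad (n : ℤ) : Module.End ℂ Fock where
  toFun f := ∑ᶠ k : ℤ, normalProd z n k f
  map_add' f g := by
    simp only [normalProd_add]
    exact finsum_add_distrib (finite_normalProd z n f) (finite_normalProd z n g)
  map_smul' t f := by
    simp only [normalProd_smul, RingHom.id_apply]
    exact (smul_finsum _ _).symm

theorem quad_apply (n : ℤ) (f : Fock) : quad z n f = ∑ᶠ k : ℤ, normalProd z n k f := rfl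

theorem quad_current (n m : ℤ) (s : Bool) (f : Fock) :
    quad z n (current z s m f) =
      current z s m (quad z n f) + -(m : ℂ) • current z s (n + m) f := by
  have h1 : (Function.support fun k => current z s m (normalProd z n k f)).Finite :=
    (finite_normalProd z n f).subset fun k hk h0 => hk (by simp only [h0, map_zero])
  have h2 : ∀ (a : ℤ) (y : Fock), (Function.support fun k : ℤ => if k = a then y else 0).Finite :=
    fun a y => (Set.finite_singleton a).subset fun i hi => by
      by_contra h
      exact hi (if_neg h)
  rw [quad_apply, quad_apply, finsum_congr fun k => normalProd_current z n k m s f,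
    finsum_add_distrib h1 (h2 _ _), IsLevelZeroRep.map_finsum' _ (finite_normalProd z n f)]
  congr 1
  rw [finsum_eq_single _ _ fun i hi => if_neg hi, if_pos rfl]

variable (ρ : Bool → ℂ)

/-- The Virasoro mode `n` on the Fock space, with background charges `ρ`. -/
noncomputable def vir (n : ℤ) : Module.End ℂ Fock :=
  quad z n + ((n : ℂ) + 1) • (ρ true • current z true n + ρ false • current z false n)

theorem vir_apply (n : ℤ) (f : Fock) : vir z ρ n f = quad z n f +
    ((n : ℂ) + 1) • (ρ true • current z true n f + ρ false • current z false n f) := rfl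

/-- The anomaly comes from the background charge alone: contracting (n + 1) ρ(!s) times the opposite
current with mode -n gives ρ(!s)(n² + n). For `s = true` this forces C_LI = -ρ(false). -/
theorem vir_current (n m : ℤ) (s : Bool) (f : Fock) :
    vir z ρ n (current z s m f) = current z s m (vir z ρ n f) +
      -(m : ℂ) • current z s (n + m) f +
      (if n = -m then ρ (!s) * ((n : ℂ) ^ 2 + n) else 0) • f := by
  rw [vir_apply, vir_apply, quad_current, current_comm z true s n m, current_comm z false s n m]
  simp only [map_add, map_smul]
  cases s <;>
  · simp only [Bool.not_false, Bool.not_true, true_and, Bool.false_eq_true, Bool.true_eq_false,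
      false_and, if_false]
    split_ifs <;> module

end Fock

/-! ### The Virasoro relations on the Fock space -/

namespace Fock

open MvPolynomial

variable (z ρ : Bool → ℂ)

theorem vir_one_of_pos (n : ℤ) (hn : 0 < n) : vir z ρ n 1 = 0 := by
  rw [vir_apply, current_one _ _ _ hn, current_one _ _ _ hn, quad_apply,
    finsum_eq_zero_of_forall_eq_zero]
  · simp
  · intro k
    unfold normalProd
    split_ifs with h
    · rw [current_one _ _ _ (by omega), map_zero]
    · rcases (show 0 ≤ k by omega).lt_or_eq with h' | rfl
      · rw [current_one _ _ _ h', map_zero]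
      · rw [current_zero, map_smul, current_one _ _ _ (by omega), smul_zero]

/-- The lowest `L 0`-eigenvalue on the Fock space. -/
noncomputable def lowestWeight : ℂ :=
  z true * z false + ρ true * z true + ρ false * z false

theorem vir_zero_one : vir z ρ 0 1 = lowestWeight z ρ • 1 := by
  rw [vir_apply, quad_apply, finsum_eq_single _ 0]
  · unfold normalProd lowestWeight
    simp only [lt_irrefl, if_false, sub_zero, current_zero, Int.cast_zero]
    module
  · intro k hk
    unfold normalProd
    split_ifs with h
    · rw [current_one _ _ _ (by omega), map_zero]
    · rw [current_one _ true _ (by omega), map_zero]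

/-- In a normally ordered term applied to the vacuum, any positive mode kills, which leaves -n ≤ k ≤
0. -/
theorem quad_neg_one (n : ℕ) : quad z (-n) 1 =
    ∑ j ∈ Finset.range (n + 1), normalProd z (-n) (-j) 1 := by
  classical
  rw [quad_apply, finsum_eq_sum_of_support_subset (s := (Finset.range (n + 1)).image
    fun j : ℕ => -(j : ℤ))]
  · rw [Finset.sum_image fun a _ b _ h => by simpa using h]
  · intro k hk
    rw [Function.mem_support] at hk
    simp only [Finset.coe_image, Set.mem_image, Finset.mem_coe, Finset.mem_range]
    have h0 : k ≤ 0 := by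
      by_contra h
      refine hk ?_
      rw [normalProd, if_neg (by omega), current_one _ _ _ (by omega), map_zero]
    refine ⟨(-k).toNat, ?_, by omega⟩
    by_contra h
    refine hk ?_
    rw [normalProd, if_pos (by omega), current_one _ false _ (by omega), map_zero]

theorem vir_current_one (n : ℤ) (hn : 0 < n) (s : Bool) (j : ℕ) :
    vir z ρ n (current z s (-j) 1) = (j : ℂ) • current z s (n - j) 1 +
      (if n = j then ρ (!s) * ((n : ℂ) ^ 2 + n) else 0) • 1 := by
  rw [vir_current, vir_one_of_pos _ _ _ hn, map_zero, zero_add, neg_neg]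
  push_cast
  rw [neg_neg, ← sub_eq_add_neg]

/-- For 0 < j < n only the double contraction j (n - j) survives. At the ends j = 0 and j = n one
factor is a zero mode, and the other is contracted once and picks up the background charge. -/
theorem vir_normalProd_one (n j : ℕ) (hn : 0 < n) (hj : j ≤ n) :
    vir z ρ n (normalProd z (-n) (-j) 1) = ((j : ℂ) * (n - j) +
      (if j = n then z false * (n * z true + ρ false * ((n : ℂ) ^ 2 + n)) else 0) +
      if j = 0 then z true * (n * z false + ρ true * ((n : ℂ) ^ 2 + n)) else 0) •
        (1 : Fock) := by
  have hn' : (0 : ℤ) < n := by omega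
  rcases Nat.eq_zero_or_pos j with rfl | hj0
  · unfold normalProd
    rw [if_neg (by simp), if_pos rfl, if_neg (by omega)]
    simp only [Nat.cast_zero, neg_zero, sub_zero, current_zero, map_smul]
    rw [vir_current_one _ _ _ hn', sub_self, current_zero, if_pos (by simp)]
    simp only [Bool.not_false, Int.cast_natCast]
    module
  · obtain ⟨i, rfl⟩ := Nat.exists_eq_add_of_le hj
    have h1 : -((j + i : ℕ) : ℤ) - -(j : ℤ) = -(i : ℤ) := by push_cast; ring
    have h2 : ((j + i : ℕ) : ℤ) - (i : ℤ) = j := by push_cast; ring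
    have h3 : ((j + i : ℕ) : ℤ) + -(j : ℤ) = i := by push_cast; ring
    rw [normalProd, if_pos (by omega), h1, vir_current, vir_current_one _ _ _ hn', h2, h3,
      current_one _ _ _ (by omega), if_neg (by omega : ¬ ((j + i : ℕ) : ℤ) = i), current_comm,
      if_neg (by omega : ¬ j = 0)]
    rcases Nat.eq_zero_or_pos i with rfl | hi
    · simp [current_zero]
      module
    · rw [current_one _ true _ (by omega), if_pos ⟨rfl, by omega⟩, if_neg (by omega)]
      simp [hi.ne', smul_smul]

/-- The value is 2 · (n³ - n)/12: two free currents contribute central charge 2. -/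
theorem sum_range_mul_sub (n : ℕ) :
    ∑ j ∈ Finset.range (n + 1), ((j : ℂ) * (n - j)) = ((n : ℂ) ^ 3 - n) / 6 := by
  have h1 : ∀ m : ℕ, ∀ a : ℂ, ∑ j ∈ Finset.range (m + 1), ((j : ℂ) * (a - j)) =
      a * (m * (m + 1)) / 2 - m * (m + 1) * (2 * m + 1) / 6 := by
    intro m a
    induction m with
    | zero => simp
    | succ m ih =>
      rw [Finset.sum_range_succ, ih]
      push_cast
      ring
  rw [h1]
  ring

/-- This vacuum value fixes the central charge. The part -24 ρ(true) ρ(false) arises from the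
background terms, whose prefactors combine as 2 (1 - n)(n² + n). -/
theorem vir_vir_neg_one (n : ℕ) (hn : 0 < n) : vir z ρ n (vir z ρ (-n) 1) =
    (2 * n * lowestWeight z ρ + ((n : ℂ) ^ 3 - n) / 12 * (2 - 24 * (ρ true * ρ false))) •
      (1 : Fock) := by
  have hn' : (0 : ℤ) < n := by omega
  rw [vir_apply z ρ (-n), quad_neg_one, map_add, map_sum, map_smul, map_add, map_smul, map_smul,
    vir_current_one _ _ _ hn', vir_current_one _ _ _ hn', sub_self, current_zero, current_zero,
    if_pos rfl, if_pos rfl,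
    Finset.sum_congr rfl fun j hj => vir_normalProd_one z ρ n j hn (by simp at hj; omega),
    ← Finset.sum_smul, Finset.sum_add_distrib, Finset.sum_add_distrib, sum_range_mul_sub,
    Finset.sum_ite_eq', Finset.sum_ite_eq', if_pos (by simp), if_pos (by simp), lowestWeight]
  simp only [Bool.not_false, Bool.not_true, Int.cast_natCast, Int.cast_neg]
  module

theorem constantCoeff_current_neg (s : Bool) (n : ℤ) (hn : n < 0) (f : Fock) :
    constantCoeff (current z s n f) = 0 := by
  obtain ⟨m, rfl⟩ : ∃ m : ℕ, n = -((m : ℤ) + 1) := ⟨(-n - 1).toNat, by omega⟩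
  rw [current_neg, map_mul, constantCoeff_X, zero_mul]

theorem constantCoeff_vir_one (n : ℤ) (hn : n ≠ 0) : constantCoeff (vir z ρ n 1) = 0 := by
  rcases lt_or_gt_of_ne hn with h | h
  · obtain ⟨m, rfl⟩ : ∃ m : ℕ, n = -(m : ℤ) := ⟨(-n).toNat, by omega⟩
    rw [vir_apply, quad_neg_one]
    simp only [map_add, map_sum, smul_eq_C_mul, map_mul, constantCoeff_current_neg z _ _ h,
      mul_zero, add_zero]
    refine Finset.sum_eq_zero fun j hj => ?_
    unfold normalProd
    split_ifs with h'
    · exact constantCoeff_current_neg z _ _ h' _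
    · exact constantCoeff_current_neg z _ _ (by omega) _
  · rw [vir_one_of_pos _ _ _ h, map_zero]

theorem vir_zero_X_mul (i : Bool × ℕ) (f : Fock) :
    vir z ρ 0 (X i * f) = X i * vir z ρ 0 f + ((i.2 : ℂ) + 1) • (X i * f) := by
  rw [← current_neg z i.1 i.2, vir_current, if_neg (by omega), zero_add, ← current_neg z i.1 i.2]
  push_cast
  simp

theorem constantCoeff_vir_zero (f : Fock) :
    constantCoeff (vir z ρ 0 f) = lowestWeight z ρ * constantCoeff f := by
  induction f using MvPolynomial.induction_on with
  | C a =>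
    rw [← mul_one (C a), ← smul_eq_C_mul, map_smul, vir_zero_one]
    simp [smul_eq_C_mul, mul_comm]
  | add f g hf hg => rw [map_add, map_add, hf, hg, map_add, mul_add]
  | mul_X f i hf =>
    rw [mul_comm, vir_zero_X_mul]
    simp [smul_eq_C_mul]

/-- The failure of the operators `vir n` to satisfy the Witt relations. -/
noncomputable def wittDefect (n m : ℤ) : Module.End ℂ Fock :=
  vir z ρ n * vir z ρ m - vir z ρ m * vir z ρ n - ((n : ℂ) - m) • vir z ρ (n + m)

theorem wittDefect_apply (n m : ℤ) (f : Fock) : wittDefect z ρ n m f =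
    vir z ρ n (vir z ρ m f) - vir z ρ m (vir z ρ n f) - ((n : ℂ) - m) • vir z ρ (n + m) f := rfl

/-- The adjoint action of the modes on currents satisfies the Witt relations, anomalies included, so
the defect commutes with every current. It is then a scalar by `eq_smul_of_commute`, and evaluating
it on the vacuum determines it. -/
theorem wittDefect_current (n m : ℤ) (s : Bool) (k : ℤ) (f : Fock) :
    wittDefect z ρ n m (current z s k f) = current z s k (wittDefect z ρ n m f) := by
  simp only [wittDefect_apply, vir_current, map_add, map_sub, map_smul]
  have h1 : n + (m + k) = n + m + k := by ring
  have h2 : m + (n + k) = n + m + k := by ring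
  have h3 : n = -(m + k) ↔ n + m = -k := by omega
  have h4 : m = -(n + k) ↔ n + m = -k := by omega
  simp only [h1, h2, h3, h4]
  by_cases h : n + m = -k
  · have hk : (k : ℂ) = -(n + m) := by
      rw [← neg_eq_iff_eq_neg] at h
      rw [← h]
      push_cast
      ring
    simp only [if_pos h]
    push_cast
    rw [hk]
    module
  · simp only [if_neg h]
    push_cast
    module

theorem wittDefect_eq (n m : ℤ) (f : Fock) :
    wittDefect z ρ n m f = constantCoeff (wittDefect z ρ n m 1) • f :=
  eq_smul_of_commute z _ (fun s k f => wittDefect_current z ρ n m s k f) f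

theorem wittDefect_zero (m : ℤ) (f : Fock) : wittDefect z ρ 0 m f = 0 := by
  have h : constantCoeff (wittDefect z ρ 0 m 1) = (m : ℂ) * constantCoeff (vir z ρ m 1) := by
    rw [wittDefect_apply, vir_zero_one, map_smul, map_sub, map_sub, constantCoeff_vir_zero,
      zero_add]
    simp [smul_eq_C_mul]
  rw [wittDefect_eq, h]
  by_cases hm : m = 0
  · simp [hm]
  · rw [constantCoeff_vir_one _ _ _ hm, mul_zero, zero_smul]

theorem vir_zero_vir (m : ℤ) (f : Fock) :
    vir z ρ 0 (vir z ρ m f) = vir z ρ m (vir z ρ 0 f) - (m : ℂ) • vir z ρ m f := by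
  have h := wittDefect_zero z ρ m f
  rw [wittDefect_apply, zero_add, Int.cast_zero, zero_sub, neg_smul, sub_neg_eq_add] at h
  rw [eq_sub_iff_add_eq, ← sub_eq_zero, ← h]
  abel

/-- Being a scalar, the defect commutes with `vir z ρ 0`; being of degree n + m, it has commutator
with it equal to -(n + m) times itself. -/
theorem wittDefect_of_ne (n m : ℤ) (h : n ≠ -m) (f : Fock) : wittDefect z ρ n m f = 0 := by
  have h1 : vir z ρ 0 (wittDefect z ρ n m f) =
      wittDefect z ρ n m (vir z ρ 0 f) - ((n : ℂ) + m) • wittDefect z ρ n m f := by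
    simp only [wittDefect_apply, map_sub, map_smul, vir_zero_vir]
    push_cast
    module
  rw [wittDefect_eq, wittDefect_eq z ρ n m (vir z ρ 0 f), map_smul, eq_comm, sub_eq_self,
    smul_eq_zero, ← wittDefect_eq] at h1
  refine h1.resolve_left fun h0 => h ?_
  rw [← Int.cast_add, Int.cast_eq_zero] at h0
  omega

theorem wittDefect_skew (n m : ℤ) (f : Fock) : wittDefect z ρ n m f = -wittDefect z ρ m n f := by
  rw [wittDefect_apply, wittDefect_apply, add_comm m n]
  module

theorem wittDefect_neg (n : ℤ) (f : Fock) : wittDefect z ρ n (-n) f =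
    (((n : ℂ) ^ 3 - n) / 12 * (2 - 24 * (ρ true * ρ false))) • f := by
  -- For positive n the mode n kills the vacuum, so the scalar is read off from `vir_vir_neg_one`;
  -- negative n follows by skew-symmetry.
  have hpos : ∀ n : ℕ, 0 < n → ∀ f, wittDefect z ρ n (-n) f =
      (((n : ℂ) ^ 3 - n) / 12 * (2 - 24 * (ρ true * ρ false))) • f := by
    intro n hn f
    rw [wittDefect_eq]
    congr 1
    rw [wittDefect_apply, vir_vir_neg_one z ρ n hn, vir_one_of_pos _ _ _ (by omega), map_zero,
      sub_zero, add_neg_cancel, vir_zero_one, smul_smul, ← sub_smul, smul_eq_C_mul, mul_one,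
      constantCoeff_C]
    push_cast
    ring
  obtain ⟨m, rfl | rfl⟩ := n.eq_nat_or_neg
  · rcases Nat.eq_zero_or_pos m with rfl | hm
    · simp [wittDefect_zero]
    · exact_mod_cast hpos m hm f
  · rcases Nat.eq_zero_or_pos m with rfl | hm
    · simp [wittDefect_zero]
    · rw [wittDefect_skew, neg_neg, hpos m hm, ← neg_smul]
      congr 1
      push_cast
      ring

theorem vir_vir (n m : ℤ) (f : Fock) :
    vir z ρ n (vir z ρ m f) = vir z ρ m (vir z ρ n f) + ((n : ℂ) - m) • vir z ρ (n + m) f +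
      (if n = -m then ((n : ℂ) ^ 3 - n) / 12 * (2 - 24 * (ρ true * ρ false)) else 0) • f := by
  have h : wittDefect z ρ n m f =
      (if n = -m then ((n : ℂ) ^ 3 - n) / 12 * (2 - 24 * (ρ true * ρ false)) else 0) • f := by
    split_ifs with h
    · obtain rfl : m = -n := by omega
      exact wittDefect_neg z ρ n f
    · rw [wittDefect_of_ne z ρ n m h, zero_smul]
  rw [← h, wittDefect_apply]
  abel

end Fock

/-! ### The map from the level zero Verma module to the Fock space -/

namespace Fock

open MvPolynomial

variable {cL cLI h hI : ℂ} (z ρ : Bool → ℂ)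

/-- The action of the basis elements of the twisted Heisenberg-Virasoro algebra on the Fock
space. -/
noncomputable def hvirBasis : HVirBasis → Module.End ℂ Fock
  | .L n => vir z ρ n
  | .I n => current z true n
  | .CL => (2 - 24 * (ρ true * ρ false)) • 1
  | .CLI => (-ρ false) • 1
  | .CI => 0

theorem hvirBasis_br (i j : HVirBasis) :
    Finsupp.linearCombination ℂ (hvirBasis z ρ) (HVirBasis.br i j) =
      hvirBasis z ρ i * hvirBasis z ρ j - hvirBasis z ρ j * hvirBasis z ρ i := by
  rcases i with n | n | _ | _ | _ <;> rcases j with m | m | _ | _ | _ <;>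
    refine LinearMap.ext fun x => ?_ <;>
    simp only [HVirBasis.br, hvirBasis, map_add, map_sub, map_neg, map_zero,
      Finsupp.linearCombination_single, LinearMap.add_apply, LinearMap.sub_apply,
      LinearMap.neg_apply, LinearMap.smul_apply, LinearMap.zero_apply, Module.End.mul_apply,
      Module.End.one_apply, map_smul, sub_self, smul_zero]
  · rw [vir_vir z ρ n m x, ← ite_zero_mul]
    module
  · rw [vir_current z ρ n m, Bool.not_true]
    split_ifs <;> module
  · rw [vir_current z ρ m n, Bool.not_true]
    split_ifs <;> module
  · rw [current_comm z true true n m, if_neg (by simp)]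
    simp
  · rw [smul_comm, sub_self]
  · rw [smul_comm, sub_self]

attribute [local instance 100] LieRing.ofAssociativeRing

/-- The representation of the twisted Heisenberg-Virasoro algebra on the Fock space. -/
noncomputable def hvirRep : HVir →ₗ⁅ℂ⁆ Module.End ℂ Fock where
  toFun x := Finsupp.linearCombination ℂ (hvirBasis z ρ) x
  map_add' x y := map_add (Finsupp.linearCombination ℂ (hvirBasis z ρ)) x y
  map_smul' t x := map_smul (Finsupp.linearCombination ℂ (hvirBasis z ρ)) t x
  map_lie' {x y} :=
    StructureConstants.linearCombination_bracket HVirBasis.br _ (hvirBasis_br z ρ) x y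

/-- The resulting action of the enveloping algebra on the Fock space. -/
noncomputable def hvirAction : HVir.U →ₐ[ℂ] Module.End ℂ Fock :=
  UniversalEnvelopingAlgebra.lift ℂ (hvirRep z ρ)

theorem hvirAction_e (i : HVirBasis) :
    hvirAction z ρ (UniversalEnvelopingAlgebra.ι ℂ (HVir.e i)) = hvirBasis z ρ i := by
  rw [hvirAction, UniversalEnvelopingAlgebra.lift_ι_apply]
  change Finsupp.linearCombination ℂ (hvirBasis z ρ) (Finsupp.single i 1) = _
  simp

theorem hvirAction_one_eq_zero (hcL : cL = 2 - 24 * (ρ true * ρ false)) (hcLI : cLI = -ρ false)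
    (hh : h = lowestWeight z ρ) (hhI : hI = z true) {u : HVir.U}
    (hu : u ∈ HVir.vermaIdeal cL 0 cLI h hI) : hvirAction z ρ u 1 = 0 := by
  induction hu using Submodule.span_induction with
  | mem x hx =>
    cases hx with
    | L_pos n hn =>
      rw [HVir.L, hvirAction_e]
      exact vir_one_of_pos z ρ n hn
    | I_pos n hn =>
      rw [HVir.I, hvirAction_e]
      exact current_one z true n hn
    | L_zero =>
      rw [map_sub, HVir.L, hvirAction_e, AlgHom.commutes, LinearMap.sub_apply, sub_eq_zero, hh]
      exact vir_zero_one z ρ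
    | I_zero =>
      rw [map_sub, HVir.I, hvirAction_e, AlgHom.commutes, LinearMap.sub_apply, sub_eq_zero, hhI]
      rfl
    | CL =>
      rw [map_sub, HVir.CL, hvirAction_e, AlgHom.commutes, LinearMap.sub_apply, sub_eq_zero, hcL]
      rfl
    | CI =>
      rw [map_sub, HVir.CI, hvirAction_e, AlgHom.commutes]
      simp [hvirBasis]
    | CLI =>
      rw [map_sub, HVir.CLI, hvirAction_e, AlgHom.commutes, LinearMap.sub_apply, sub_eq_zero, hcLI]
      rfl
  | zero => simp
  | add x y _ _ hx hy => rw [map_add, LinearMap.add_apply, hx, hy, add_zero]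
  | smul a x _ hx => rw [smul_eq_mul, map_mul, Module.End.mul_apply, hx, map_zero]

/-- The homomorphism from the level zero Verma module to the Fock space that sends the highest
weight vector to `1`. -/
noncomputable def ofVerma (hcL : cL = 2 - 24 * (ρ true * ρ false)) (hcLI : cLI = -ρ false)
    (hh : h = lowestWeight z ρ) (hhI : hI = z true) : HVir.Verma cL 0 cLI h hI →ₗ[ℂ] Fock :=
  (((HVir.vermaIdeal cL 0 cLI h hI).restrictScalars ℂ).liftQ
    ((LinearMap.applyₗ (1 : Fock)).comp (hvirAction z ρ).toLinearMap)
    (fun _ hu => hvirAction_one_eq_zero z ρ hcL hcLI hh hhI hu)).comp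
      (Submodule.Quotient.restrictScalarsEquiv ℂ (HVir.vermaIdeal cL 0 cLI h hI)).symm.toLinearMap

variable (hcL : cL = 2 - 24 * (ρ true * ρ false)) (hcLI : cLI = -ρ false)
    (hh : h = lowestWeight z ρ) (hhI : hI = z true)

theorem ofVerma_mk (u : HVir.U) :
    ofVerma z ρ hcL hcLI hh hhI (Submodule.Quotient.mk u) = hvirAction z ρ u 1 := rfl

theorem ofVerma_hwv : ofVerma z ρ hcL hcLI hh hhI (HVir.hwv cL 0 cLI h hI) = 1 := by
  rw [HVir.hwv, ofVerma_mk, map_one (hvirAction z ρ), Module.End.one_apply]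

theorem ofVerma_smul (u : HVir.U) (x : HVir.Verma cL 0 cLI h hI) :
    ofVerma z ρ hcL hcLI hh hhI (u • x) = hvirAction z ρ u (ofVerma z ρ hcL hcLI hh hhI x) := by
  induction x using Submodule.Quotient.induction_on with
  | H y =>
    rw [← Submodule.Quotient.mk_smul, smul_eq_mul, ofVerma_mk, ofVerma_mk, map_mul,
      Module.End.mul_apply]

theorem ofVerma_L (n : ℤ) (x : HVir.Verma cL 0 cLI h hI) :
    ofVerma z ρ hcL hcLI hh hhI (HVir.L n • x) = vir z ρ n (ofVerma z ρ hcL hcLI hh hhI x) := by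
  rw [ofVerma_smul, HVir.L, hvirAction_e]
  rfl

theorem ofVerma_I (n : ℤ) (x : HVir.Verma cL 0 cLI h hI) :
    ofVerma z ρ hcL hcLI hh hhI (HVir.I n • x) =
      current z true n (ofVerma z ρ hcL hcLI hh hhI x) := by
  rw [ofVerma_smul, HVir.I, hvirAction_e]
  rfl

end Fock

/-! ### Spanning sets and the `L 0`-grading of the W(2,2) Verma module -/

namespace W22

variable {cL cW h hW : ℂ}

theorem smul_hwv (u : U) : u • hwv cL cW h hW = Submodule.Quotient.mk u := by
  rw [hwv, ← Submodule.Quotient.mk_smul, smul_eq_mul, mul_one]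

theorem smul_hwv_eq_zero {u : U} (hu : VermaRel cL cW h hW u) : u • hwv cL cW h hW = 0 := by
  rw [smul_hwv]
  exact (Submodule.Quotient.mk_eq_zero _).2 (Submodule.subset_span hu)

theorem smul_hwv_eq_smul {u : U} {a : ℂ} (hu : VermaRel cL cW h hW (u - algebraMap ℂ U a)) :
    u • hwv cL cW h hW = a • hwv cL cW h hW := by
  have := smul_hwv_eq_zero hu
  rwa [sub_smul, sub_eq_zero, algebraMap_smul] at this

theorem lie_e (i j : W22Basis) : ⁅e i, e j⁆ = (W22Basis.br i j : W22Basis →₀ ℂ) :=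
  StructureConstants.bracket_single _ i j

theorem single_eq (i : W22Basis) (t : ℂ) : (Finsupp.single i t : W22Basis →₀ ℂ) = (t • e i : W22) :=
  (Finsupp.smul_single_one i t).symm

theorem ι_smul_ι_smul (x y : W22) (v : Verma cL cW h hW) :
    UniversalEnvelopingAlgebra.ι ℂ x • UniversalEnvelopingAlgebra.ι ℂ y • v =
      UniversalEnvelopingAlgebra.ι ℂ y • UniversalEnvelopingAlgebra.ι ℂ x • v +
        UniversalEnvelopingAlgebra.ι ℂ ⁅x, y⁆ • v := by
  rw [UniversalEnvelopingAlgebra.ι_lie, sub_smul, mul_smul, mul_smul]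
  abel

theorem ι_smul_mem (S : Submodule ℂ (Verma cL cW h hW)) (v : Verma cL cW h hW)
    (hS : ∀ i, UniversalEnvelopingAlgebra.ι ℂ (e i) • v ∈ S) (x : W22) :
    UniversalEnvelopingAlgebra.ι ℂ x • v ∈ S := by
  induction x using Finsupp.induction_linear with
  | zero =>
    have : UniversalEnvelopingAlgebra.ι ℂ (0 : W22) • v ∈ S := by
      rw [map_zero, zero_smul]
      exact S.zero_mem
    exact this
  | add y z hy hz =>
    have : UniversalEnvelopingAlgebra.ι ℂ ((id y : W22) + (id z : W22)) • v ∈ S := by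
      rw [map_add, add_smul]
      exact S.add_mem hy hz
    exact this
  | single i t =>
    have : UniversalEnvelopingAlgebra.ι ℂ (t • e i) • v ∈ S := by
      rw [map_smul, smul_assoc]
      exact S.smul_mem t (hS i)
    rw [single_eq]
    exact this

/-- The basis elements with negative mode: `W (-(m + 1))` for the index `(true, m)` and
`L (-(m + 1))` for the index `(false, m)`. -/
def negBasis : Bool × ℕ → W22Basis
  | (true, m) => .W (-((m : ℤ) + 1))
  | (false, m) => .L (-((m : ℤ) + 1))

/-- The element of the enveloping algebra that corresponds to `negBasis i`. -/
noncomputable def neg (i : Bool × ℕ) : U := UniversalEnvelopingAlgebra.ι ℂ (e (negBasis i))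

/-- The product of the elements `neg i` along a list, applied to the highest weight vector. -/
noncomputable def word (cL cW h hW : ℂ) (l : List (Bool × ℕ)) : Verma cL cW h hW :=
  (l.map neg).prod • hwv cL cW h hW

theorem word_nil : word cL cW h hW [] = hwv cL cW h hW := by
  simp [word]

theorem word_cons (i : Bool × ℕ) (l : List (Bool × ℕ)) :
    word cL cW h hW (i :: l) = neg i • word cL cW h hW l := by
  simp [word, mul_smul]

theorem ι_smul_hwv_mem (S : Submodule ℂ (Verma cL cW h hW)) (h0 : hwv cL cW h hW ∈ S)
    (hS : ∀ i, neg i • hwv cL cW h hW ∈ S) (j : W22Basis) :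
    UniversalEnvelopingAlgebra.ι ℂ (e j) • hwv cL cW h hW ∈ S := by
  rcases j with n | n | _ | _
  · rcases lt_trichotomy n 0 with hn | rfl | hn
    · obtain ⟨m, rfl⟩ : ∃ m : ℕ, n = -((m : ℤ) + 1) := ⟨(-n - 1).toNat, by omega⟩
      exact hS (false, m)
    · have := smul_hwv_eq_smul (.L_zero (cL := cL) (cW := cW) (h := h) (hW := hW))
      rw [L] at this
      rw [this]
      exact S.smul_mem _ h0
    · have := smul_hwv_eq_zero (.L_pos (cL := cL) (cW := cW) (h := h) (hW := hW) n hn)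
      rw [L] at this
      rw [this]
      exact S.zero_mem
  · rcases lt_trichotomy n 0 with hn | rfl | hn
    · obtain ⟨m, rfl⟩ : ∃ m : ℕ, n = -((m : ℤ) + 1) := ⟨(-n - 1).toNat, by omega⟩
      exact hS (true, m)
    · have := smul_hwv_eq_smul (.W_zero (cL := cL) (cW := cW) (h := h) (hW := hW))
      rw [W] at this
      rw [this]
      exact S.smul_mem _ h0
    · have := smul_hwv_eq_zero (.W_pos (cL := cL) (cW := cW) (h := h) (hW := hW) n hn)
      rw [W] at this
      rw [this]
      exact S.zero_mem
  · have := smul_hwv_eq_smul (.C (cL := cL) (cW := cW) (h := h) (hW := hW))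
    rw [C] at this
    rw [this]
    exact S.smul_mem _ h0
  · have := smul_hwv_eq_smul (.CW (cL := cL) (cW := cW) (h := h) (hW := hW))
    rw [CW] at this
    rw [this]
    exact S.smul_mem _ h0

theorem neg_smul_mem_span_word (i : Bool × ℕ) {v : Verma cL cW h hW}
    (hv : v ∈ Submodule.span ℂ (Set.range (word cL cW h hW))) :
    neg i • v ∈ Submodule.span ℂ (Set.range (word cL cW h hW)) := by
  induction hv using Submodule.span_induction with
  | mem x hx =>
    obtain ⟨l, rfl⟩ := hx
    exact Submodule.subset_span ⟨i :: l, word_cons i l⟩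
  | zero => rw [smul_zero]; exact Submodule.zero_mem _
  | add x y _ _ hx hy => rw [smul_add]; exact Submodule.add_mem _ hx hy
  | smul t x _ hx => rw [smul_comm]; exact Submodule.smul_mem _ _ hx

/-- Moving a generator past the first letter leaves its bracket with that letter acting on a shorter
word, so induction on the word applies. -/
theorem ι_smul_word_mem (l : List (Bool × ℕ)) : ∀ j : W22Basis,
    UniversalEnvelopingAlgebra.ι ℂ (e j) • word cL cW h hW l ∈
      Submodule.span ℂ (Set.range (word cL cW h hW)) := by
  induction l with
  | nil =>
    intro j
    rw [word_nil]
    refine ι_smul_hwv_mem (Submodule.span ℂ (Set.range (word cL cW h hW)))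
      (Submodule.subset_span ⟨[], word_nil⟩) (fun i => ?_) j
    exact Submodule.subset_span ⟨[i], by rw [word_cons, word_nil]⟩
  | cons i l ih =>
    intro j
    rw [word_cons, neg, ι_smul_ι_smul]
    exact Submodule.add_mem _ (neg_smul_mem_span_word i (ih j)) (ι_smul_mem _ _ ih _)

theorem span_word : Submodule.span ℂ (Set.range (word cL cW h hW)) = ⊤ := by
  refine (Submodule.eq_top_iff').2 fun v => ?_
  have hmem : ∀ (x : W22), ∀ w ∈ Submodule.span ℂ (Set.range (word cL cW h hW)),
      UniversalEnvelopingAlgebra.ι ℂ x • w ∈ Submodule.span ℂ (Set.range (word cL cW h hW)) := by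
    intro x w hw
    induction hw using Submodule.span_induction with
    | mem w hw =>
      obtain ⟨l, rfl⟩ := hw
      exact ι_smul_mem _ _ (ι_smul_word_mem l) x
    | zero => rw [smul_zero]; exact Submodule.zero_mem _
    | add x y _ _ hx hy => rw [smul_add]; exact Submodule.add_mem _ hx hy
    | smul t x _ hx => rw [smul_comm]; exact Submodule.smul_mem _ _ hx
  let A : Subalgebra ℂ U :=
    { carrier := {u | ∀ w ∈ Submodule.span ℂ (Set.range (word cL cW h hW)),
        u • w ∈ Submodule.span ℂ (Set.range (word cL cW h hW))}
      mul_mem' := fun {a b} ha hb x hx => by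
        rw [mul_smul]; exact ha _ (hb _ hx)
      add_mem' := fun {a b} ha hb x hx => by
        rw [add_smul]; exact Submodule.add_mem _ (ha _ hx) (hb _ hx)
      algebraMap_mem' := fun t x hx => by
        rw [algebraMap_smul]; exact Submodule.smul_mem _ _ hx }
  induction v using Submodule.Quotient.induction_on with
  | H u =>
    rw [← smul_hwv]
    have hv : hwv cL cW h hW ∈ Submodule.span ℂ (Set.range (word cL cW h hW)) :=
      Submodule.subset_span ⟨[], word_nil⟩
    have hu : u ∈ A := UniversalEnvelopingAlgebra.induction_of_generators A hmem u
    exact hu _ hv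

/-- Two negative modes never sum to zero, so no central term arises. A bracket is thus a multiple of
one letter, which makes reordering shorten words. -/
theorem br_negBasis (i j : Bool × ℕ) :
    ∃ (t : ℂ) (k : Bool × ℕ), ⁅e (negBasis i), e (negBasis j)⁆ = t • e (negBasis k) := by
  have hmode (a b : ℕ) : -((a : ℤ) + 1) + -((b : ℤ) + 1) = -(((a + b + 1 : ℕ) : ℤ) + 1) := by
    push_cast
    ring
  have hne (a b : ℕ) : ¬ -((a : ℤ) + 1) = - -((b : ℤ) + 1) := by omega
  rcases i with ⟨_ | _, a⟩ <;> rcases j with ⟨_ | _, b⟩ <;> rw [lie_e] <;>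
    simp only [negBasis, W22Basis.br, if_neg (hne _ _), Finsupp.single_zero, add_zero, hmode]
  · exact ⟨_, (false, a + b + 1), single_eq _ _⟩
  · exact ⟨_, (true, a + b + 1), single_eq _ _⟩
  · refine ⟨-(((-((b : ℤ) + 1) : ℤ) : ℂ) - ((-((a : ℤ) + 1) : ℤ) : ℂ)), (true, b + a + 1), ?_⟩
    rw [_root_.neg_smul]
    exact congrArg Neg.neg (single_eq _ _)
  -- Two W modes commute; the index here is arbitrary.
  · exact ⟨0, (true, 0), (zero_smul ℂ (e (negBasis (true, 0)))).symm⟩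

/-- The span of the words of length less than `n`. -/
noncomputable def wordsBelow (cL cW h hW : ℂ) (n : ℕ) : Submodule ℂ (Verma cL cW h hW) :=
  Submodule.span ℂ {v | ∃ l : List (Bool × ℕ), l.length < n ∧ word cL cW h hW l = v}

theorem neg_smul_mem_wordsBelow (i : Bool × ℕ) (n : ℕ) {v : Verma cL cW h hW}
    (hv : v ∈ wordsBelow cL cW h hW n) : neg i • v ∈ wordsBelow cL cW h hW (n + 1) := by
  induction hv using Submodule.span_induction with
  | mem x hx =>
    obtain ⟨l, hl, rfl⟩ := hx
    exact Submodule.subset_span ⟨i :: l, by simpa using hl, word_cons i l⟩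
  | zero => rw [smul_zero]; exact Submodule.zero_mem _
  | add x y _ _ hx hy => rw [smul_add]; exact Submodule.add_mem _ hx hy
  | smul t x _ hx => rw [smul_comm]; exact Submodule.smul_mem _ _ hx

/-- Swapping adjacent letters costs their bracket, a multiple of a word that is one letter shorter.
-/
theorem word_sub_word_mem {l l' : List (Bool × ℕ)} (hl : l.Perm l') :
    word cL cW h hW l - word cL cW h hW l' ∈ wordsBelow cL cW h hW l.length := by
  induction hl with
  | nil => rw [sub_self]; exact Submodule.zero_mem _
  | cons i _ ih =>
    rw [word_cons, word_cons, ← smul_sub]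
    exact neg_smul_mem_wordsBelow i _ ih
  | swap i j l =>
    obtain ⟨t, k, hk⟩ := br_negBasis j i
    rw [word_cons, word_cons, word_cons, word_cons, neg, neg, ι_smul_ι_smul, add_sub_cancel_left,
      hk, map_smul, smul_assoc]
    exact Submodule.smul_mem _ _ (Submodule.subset_span ⟨k :: l, by simp, word_cons k l⟩)
  | trans h1 _ ih1 ih2 =>
    rw [← h1.length_eq] at ih2
    rw [← sub_add_sub_cancel]
    exact Submodule.add_mem _ ih1 ih2

/-- Modulo shorter words the order of letters is irrelevant, so one ordering per multiset suffices.
Multisets also index the monomials of the Fock space, and this matching replaces a linear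
independence statement. -/
theorem span_word_multiset :
    Submodule.span ℂ (Set.range fun m : Multiset (Bool × ℕ) => word cL cW h hW m.toList) = ⊤ := by
  have key : ∀ (n : ℕ) (l : List (Bool × ℕ)), l.length < n → word cL cW h hW l ∈
      Submodule.span ℂ (Set.range fun m : Multiset (Bool × ℕ) => word cL cW h hW m.toList) := by
    intro n
    induction n with
    | zero => intro l hl; omega
    | succ n ih =>
      intro l hl
      have hp : l.Perm (l : Multiset (Bool × ℕ)).toList := by
        rw [← Multiset.coe_eq_coe, Multiset.coe_toList]
      rw [← sub_add_cancel (word cL cW h hW l) (word cL cW h hW (l : Multiset _).toList)]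
      refine Submodule.add_mem _ ?_ (Submodule.subset_span ⟨_, rfl⟩)
      refine (Submodule.span_le.2 ?_) (word_sub_word_mem hp)
      rintro _ ⟨l', hl', rfl⟩
      exact ih l' (by omega)
  rw [eq_top_iff, ← span_word, Submodule.span_le]
  rintro _ ⟨l, rfl⟩
  exact key (l.length + 1) l (by omega)

theorem L_zero_smul_word (l : List (Bool × ℕ)) : L 0 • word cL cW h hW l =
    (h + ((l.map fun i => i.2 + 1).sum : ℕ)) • word cL cW h hW l := by
  induction l with
  | nil =>
    rw [word_nil, smul_hwv_eq_smul .L_zero]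
    simp
  | cons i l ih =>
    have hbr : ⁅e (.L 0), e (negBasis i)⁆ = ((i.2 : ℂ) + 1) • e (negBasis i) := by
      rcases i with ⟨_ | _, a⟩ <;> rw [lie_e] <;> simp only [negBasis, W22Basis.br] <;>
      · rw [if_neg (by omega), Finsupp.single_zero, add_zero, zero_add]
        refine (single_eq _ _).trans ?_
        congr 1
        push_cast
        ring
    rw [word_cons, neg, L, ι_smul_ι_smul, ← L, ih, hbr, map_smul, smul_assoc, smul_comm,
      ← add_smul, List.map_cons, List.sum_cons]
    congr 1
    push_cast
    ring

end W22

/-! ### Newton-type recursion for the Schur polynomials -/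

section SchurRecursion

theorem schurPoly_zero : schurPoly 0 = 1 := by
  rw [schurPoly, PowerSeries.coeff_subst' hasSubst_schurExponent, finsum_eq_single _ 0]
  · simp
  · intro d hd
    have h0 : PowerSeries.constantCoeff schurExponent = 0 := by
      rw [← PowerSeries.coeff_zero_eq_constantCoeff_apply, schurExponent, PowerSeries.coeff_mk,
        if_pos rfl]
    rw [PowerSeries.coeff_zero_eq_constantCoeff_apply, map_pow, h0, zero_pow hd, smul_zero]

/-- Compare coefficients in F' = g' F for F = exp g, where g' has coefficients x_{k+1}. The
subtraction is never truncated, because k < r. -/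
theorem mul_schurPoly (r : ℕ) : MvPolynomial.C (r : ℂ) * schurPoly r =
    ∑ k ∈ Finset.range r, MvPolynomial.X (k + 1) * schurPoly (r - 1 - k) := by
  rcases r with _ | r
  · simp
  have h := congrArg (PowerSeries.coeff r) (PowerSeries.derivative_subst
    (f := PowerSeries.exp (MvPolynomial ℕ ℂ)) hasSubst_schurExponent)
  rw [PowerSeries.derivative_exp, PowerSeries.coeff_derivative,
    mul_comm (PowerSeries.subst _ _) (PowerSeries.derivative _ _),
    PowerSeries.coeff_mul, Finset.Nat.sum_antidiagonal_eq_sum_range_succ_mk] at h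
  have hC (k : ℕ) : MvPolynomial.C (((k + 1 : ℕ) : ℂ)) = ((k : MvPolynomial ℕ ℂ) + 1) := by simp
  rw [schurPoly, mul_comm, hC, h, Nat.add_sub_cancel]
  refine Finset.sum_congr rfl fun k _ => ?_
  rw [PowerSeries.coeff_derivative, schurExponent, PowerSeries.coeff_mk, if_neg (by omega),
    ← schurExponent, ← schurPoly]
  congr 1
  rw [mul_comm, ← mul_assoc, ← hC, ← map_mul, mul_one_div_cancel (Nat.cast_ne_zero.2 (by omega)),
    map_one, one_mul]

end SchurRecursion

/-! ### Action of the L, I and W modes on Schur vectors -/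

namespace HVir

variable {cL cLI h hI : ℂ}

theorem schurVector_zero : schurVector cL 0 cLI h hI 0 = hwv cL 0 cLI h hI := by
  rw [schurVector, schurPoly_zero, map_one, one_smul]

/-- This recursion is the form in which the Schur vectors are used: their further properties follow
by strong induction, dividing by r in characteristic zero. -/
theorem smul_schurVector (r : ℕ) : (r : ℂ) • schurVector cL 0 cLI h hI r =
    ∑ k ∈ Finset.range r,
      (-(1 / cLI)) • I (-((k : ℤ) + 1)) • schurVector cL 0 cLI h hI (r - 1 - k) := by
  unfold schurVector
  generalize_proofs _ ha
  have h := congrArg (fun q => evalCommuting _ ha q • hwv cL 0 cLI h hI) (mul_schurPoly r)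
  simp only [map_mul, map_sum, evalCommuting_X, Finset.sum_smul, mul_smul] at h
  rw [← MvPolynomial.algebraMap_eq, AlgHom.commutes, algebraMap_smul] at h
  rw [h]
  refine Finset.sum_congr rfl fun k _ => ?_
  rw [← neg_smul, smul_assoc]
  push_cast
  rfl

theorem schurVector_mem (S : Submodule ℂ (Verma cL 0 cLI h hI)) (h0 : hwv cL 0 cLI h hI ∈ S)
    (hS : ∀ (k : ℕ), ∀ x ∈ S, I (-((k : ℤ) + 1)) • x ∈ S) (r : ℕ) :
    schurVector cL 0 cLI h hI r ∈ S := by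
  induction r using Nat.strong_induction_on with
  | _ r ih =>
    rcases r with _ | r
    · rwa [schurVector_zero]
    · have h1 : (((r + 1 : ℕ)) : ℂ) ≠ 0 := Nat.cast_ne_zero.2 (by omega)
      rw [← inv_smul_smul₀ h1 (schurVector cL 0 cLI h hI (r + 1)), smul_schurVector]
      exact S.smul_mem _ (S.sum_mem fun k _ => S.smul_mem _ (hS k _ (ih _ (by omega))))

/-- The vectors on which the modes `I k` with `k ≥ 0` act as on the highest weight vector. -/
noncomputable def iHighest (cL cLI h hI : ℂ) : Submodule ℂ (Verma cL 0 cLI h hI) where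
  carrier := {x | (∀ k : ℤ, 0 < k → I k • x = 0) ∧ I 0 • x = hI • x}
  zero_mem' := ⟨fun k _ => smul_zero _, by rw [smul_zero, smul_zero]⟩
  add_mem' := fun {x y} hx hy => ⟨fun k hk => by rw [smul_add, hx.1 k hk, hy.1 k hk, add_zero],
    by rw [smul_add, smul_add, hx.2, hy.2]⟩
  smul_mem' := fun t x hx => ⟨fun k hk => by rw [smul_comm, hx.1 k hk, smul_zero],
    by rw [smul_comm, hx.2, smul_comm]⟩

theorem hwv_mem_iHighest : hwv cL 0 cLI h hI ∈ iHighest cL cLI h hI :=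
  ⟨fun _ hk => smul_hwv_eq_zero (.I_pos _ hk), smul_hwv_eq_smul .I_zero⟩

theorem I_smul_mem_iHighest (n : ℤ) {x : Verma cL 0 cLI h hI} (hx : x ∈ iHighest cL cLI h hI) :
    I n • x ∈ iHighest cL cLI h hI :=
  ⟨fun k hk => by rw [I_smul_I_smul, hx.1 k hk, smul_zero],
    by rw [I_smul_I_smul, hx.2, smul_comm]⟩

theorem schurVector_mem_iHighest (r : ℕ) :
    schurVector cL 0 cLI h hI r ∈ iHighest cL cLI h hI :=
  schurVector_mem _ hwv_mem_iHighest (fun _ _ hx => I_smul_mem_iHighest _ hx) r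

theorem L_zero_smul_schurVector (r : ℕ) : L 0 • schurVector cL 0 cLI h hI r =
    (h + r) • schurVector cL 0 cLI h hI r := by
  induction r using Nat.strong_induction_on with
  | _ r ih =>
    rcases Nat.eq_zero_or_pos r with rfl | hr
    · rw [schurVector_zero, Nat.cast_zero, add_zero, smul_hwv_eq_smul .L_zero]
    · have h1 : (r : ℂ) ≠ 0 := Nat.cast_ne_zero.2 (by omega)
      refine smul_right_injective _ h1 ?_
      change (r : ℂ) • L 0 • _ = (r : ℂ) • _ • _
      rw [smul_comm (r : ℂ) (L 0), smul_comm (r : ℂ) (h + r), smul_schurVector, Finset.smul_sum,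
        Finset.smul_sum]
      refine Finset.sum_congr rfl fun k hk => ?_
      rw [Finset.mem_range] at hk
      obtain ⟨j, rfl⟩ : ∃ j, r = j + k + 1 := ⟨r - 1 - k, by omega⟩
      rw [show j + k + 1 - 1 - k = j by omega]
      rw [smul_comm (L 0), L_smul_I_smul, ih j (by omega), if_neg (by omega), zero_smul, sub_zero,
        zero_add]
      rw [smul_comm (I _) (h + (j : ℂ))]
      generalize I (-((k : ℤ) + 1)) • schurVector cL 0 cLI h hI j = y
      push_cast
      module

/-- This is the coefficient form of L(n) S(y) v = y^n (y d/dy + n - p) S(y) v with n = a + 1. The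
logarithmic derivative comes from the modes I(n - k) with k > n, the constant -(p + 1) from I(0),
and n + 1 from C_LI. -/
theorem L_smul_schurVector {p : ℂ} (hcLI : cLI ≠ 0) (hhI : hI = (p + 1) * cLI) (r : ℕ) :
    ∀ a : ℕ, (r ≤ a → L ((a : ℤ) + 1) • schurVector cL 0 cLI h hI r = 0) ∧
      ∀ q : ℕ, r = q + a + 1 → L ((a : ℤ) + 1) • schurVector cL 0 cLI h hI r =
        ((r : ℂ) - p) • schurVector cL 0 cLI h hI q := by
  induction r using Nat.strong_induction_on with
  | _ r ih =>
  intro a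
  rcases Nat.eq_zero_or_pos r with rfl | hr
  · refine ⟨fun _ => ?_, fun q hq => by omega⟩
    rw [schurVector_zero, smul_hwv_eq_zero (.L_pos _ (by omega))]
  have h1 : (r : ℂ) ≠ 0 := Nat.cast_ne_zero.2 (by omega)
  have hI' (j : ℕ) := schurVector_mem_iHighest (cL := cL) (cLI := cLI) (h := h) (hI := hI) j
  -- Apply L(a + 1) to the recursion: the first sum lets it act on the smaller Schur vector, the
  -- second collects commutators with I(-k-1), the central term appearing only at k = a.
  have hexp : (r : ℂ) • L ((a : ℤ) + 1) • schurVector cL 0 cLI h hI r =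
      ∑ k ∈ Finset.range r, (-(1 / cLI)) • I (-((k : ℤ) + 1)) •
        L ((a : ℤ) + 1) • schurVector cL 0 cLI h hI (r - 1 - k) +
      ∑ k ∈ Finset.range r, (-(1 / cLI)) • (((k : ℂ) + 1) • I ((a : ℤ) - k) •
        schurVector cL 0 cLI h hI (r - 1 - k) -
        (if k = a then ((((a : ℂ) + 1) ^ 2 + (a + 1)) * cLI) else 0) •
          schurVector cL 0 cLI h hI (r - 1 - k)) := by
    rw [smul_comm, smul_schurVector, Finset.smul_sum, ← Finset.sum_add_distrib]
    refine Finset.sum_congr rfl fun k _ => ?_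
    rw [smul_comm (L _), L_smul_I_smul, ← smul_add, add_sub_assoc]
    have h2 : (a : ℤ) + 1 + -((k : ℤ) + 1) = a - k := by ring
    have h3 : (a : ℤ) + 1 = - -((k : ℤ) + 1) ↔ k = a := by omega
    simp only [h2, h3]
    push_cast
    rw [neg_neg]
  refine ⟨fun hra => ?_, ?_⟩
  · refine (smul_eq_zero.1 (hexp.trans ?_)).resolve_left h1
    rw [Finset.sum_eq_zero, Finset.sum_eq_zero, add_zero]
    · intro k hk
      rw [Finset.mem_range] at hk
      rw [(hI' _).1 _ (by omega), if_neg (by omega), zero_smul, smul_zero, sub_zero, smul_zero]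
    · intro k hk
      rw [(ih (r - 1 - k) (by omega) a).1 (by omega), smul_zero, smul_zero]
  · rintro q rfl
    refine smul_right_injective _ h1 (hexp.trans ?_)
    change _ = ((q + a + 1 : ℕ) : ℂ) • (((q + a + 1 : ℕ) : ℂ) - p) • schurVector cL 0 cLI h hI q
    have hA : ∑ k ∈ Finset.range (q + a + 1), (-(1 / cLI)) • I (-((k : ℤ) + 1)) •
        L ((a : ℤ) + 1) • schurVector cL 0 cLI h hI (q + a + 1 - 1 - k) =
        ∑ k ∈ Finset.range q, ((q : ℂ) + a - k - p) • (-(1 / cLI)) • I (-((k : ℤ) + 1)) •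
          schurVector cL 0 cLI h hI (q - 1 - k) := by
      rw [add_assoc, Finset.sum_range_add, Finset.sum_eq_zero (s := Finset.range (a + 1)), add_zero]
      · refine Finset.sum_congr rfl fun k hk => ?_
        rw [Finset.mem_range] at hk
        rw [(ih (q + (a + 1) - 1 - k) (by omega) a).2 (q - 1 - k) (by omega),
          show q + (a + 1) - 1 - k = q + a - k by omega, Nat.cast_sub (by omega), smul_comm (I _),
          smul_comm (-(1 / cLI))]
        push_cast
        rfl
      · intro k _
        rw [(ih (q + (a + 1) - 1 - (q + k)) (by omega) a).1 (by omega), smul_zero, smul_zero]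
    -- Terms with k < a vanish, as they contain a positive mode of I. The term k = a combines I(0) =
    -- (p + 1) c_LI with the central term into (a + 1)(a + 1 - p), and the terms k > a are
    -- reindexed.
    have hB : ∑ k ∈ Finset.range (q + a + 1), (-(1 / cLI)) • (((k : ℂ) + 1) • I ((a : ℤ) - k) •
        schurVector cL 0 cLI h hI (q + a + 1 - 1 - k) -
        (if k = a then ((((a : ℂ) + 1) ^ 2 + (a + 1)) * cLI) else 0) •
          schurVector cL 0 cLI h hI (q + a + 1 - 1 - k)) =
        ∑ k ∈ Finset.range q, ((a : ℂ) + k + 2) • (-(1 / cLI)) • I (-((k : ℤ) + 1)) •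
          schurVector cL 0 cLI h hI (q - 1 - k) +
        (((a : ℂ) + 1) * (a + 1 - p)) • schurVector cL 0 cLI h hI q := by
      rw [show q + a + 1 = a + (q + 1) by ring, Finset.sum_range_add,
        Finset.sum_eq_zero (s := Finset.range a), zero_add, Finset.sum_range_succ']
      · congr 1
        · refine Finset.sum_congr rfl fun k hk => ?_
          rw [show a + (q + 1) - 1 - (a + (k + 1)) = q - 1 - k by omega, if_neg (by omega),
            zero_smul, sub_zero, smul_comm (-(1 / cLI)),
            show (a : ℤ) - (a + (k + 1) : ℕ) = -((k : ℤ) + 1) by push_cast; ring]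
          push_cast
          congr 1
          ring
        · rw [add_zero, show a + (q + 1) - 1 - a = q by omega, sub_self, (hI' q).2, if_pos rfl,
            hhI, smul_smul, ← sub_smul, smul_smul]
          congr 1
          field_simp
          ring
      · intro k hk
        rw [Finset.mem_range] at hk
        rw [(hI' _).1 _ (by omega), if_neg (by omega), zero_smul, smul_zero, sub_zero, smul_zero]
    rw [hA, hB, ← add_assoc, ← Finset.sum_add_distrib]
    have hC : ∀ k ∈ Finset.range q, ((q : ℂ) + a - k - p) • (-(1 / cLI)) • I (-((k : ℤ) + 1)) •
          schurVector cL 0 cLI h hI (q - 1 - k) + ((a : ℂ) + k + 2) • (-(1 / cLI)) •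
            I (-((k : ℤ) + 1)) • schurVector cL 0 cLI h hI (q - 1 - k) =
        ((q : ℂ) + 2 * a + 2 - p) • (-(1 / cLI)) • I (-((k : ℤ) + 1)) •
          schurVector cL 0 cLI h hI (q - 1 - k) := fun k _ => by
      rw [← add_smul]
      congr 1
      ring
    -- The coefficients no longer depend on k, so the recursion for q resums them: q (q + 2a + 2 -
    -- p) + (a + 1)(a + 1 - p) = (q + a + 1)(q + a + 1 - p).
    rw [Finset.sum_congr rfl hC, ← Finset.smul_sum, ← smul_schurVector]
    push_cast
    module

theorem L_pos_smul_schurVector {p : ℕ} (hcLI : cLI ≠ 0) (hhI : hI = ((p : ℂ) + 1) * cLI) (n : ℤ)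
    (hn : 0 < n) : L n • schurVector cL 0 cLI h hI p = 0 := by
  obtain ⟨a, rfl⟩ : ∃ a : ℕ, n = (a : ℤ) + 1 := ⟨(n - 1).toNat, by omega⟩
  rcases le_or_gt p a with hpa | hpa
  · exact (L_smul_schurVector hcLI hhI p a).1 hpa
  · rw [(L_smul_schurVector hcLI hhI p a).2 (p - a - 1) (by omega), sub_self, zero_smul]

theorem opW_apply (n : ℤ) (x : Verma cL 0 cLI h hI) : opW cL cLI h hI n x =
    (∑ᶠ i : ℤ, I i • I (n - i) • x) - (2 * cLI * (n + 1)) • I n • x :=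
  IsLevelZeroRep.wMode_apply _ _ _

theorem opW_pos {x : Verma cL 0 cLI h hI} (hx : x ∈ iHighest cL cLI h hI) (n : ℤ) (hn : 0 < n) :
    opW cL cLI h hI n x = 0 := by
  rw [opW_apply, hx.1 n hn, smul_zero, sub_zero, finsum_eq_zero_of_forall_eq_zero]
  intro i
  by_cases hi : 0 < i
  · rw [I_smul_I_smul, hx.1 i hi, smul_zero]
  · rw [hx.1 (n - i) (by omega), smul_zero]

theorem opW_zero {x : Verma cL 0 cLI h hI} (hx : x ∈ iHighest cL cLI h hI) :
    opW cL cLI h hI 0 x = (hI * (hI - 2 * cLI)) • x := by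
  rw [opW_apply, finsum_eq_single _ 0]
  · rw [sub_zero, hx.2, smul_comm, hx.2, Int.cast_zero]
    module
  · intro i hi
    rcases lt_or_gt_of_ne hi with h0 | h0
    · rw [hx.1 (0 - i) (by omega), smul_zero]
    · rw [I_smul_I_smul, hx.1 i h0, smul_zero]

/-- The two terms containing I(0) give 2 h_I, and -2 c_LI (n + 1) at n = -(m + 1) gives 2 c_LI m.
All other surviving terms involve only modes I(-j-1) with j < m, so W is triangular in I. -/
theorem opW_neg {x : Verma cL 0 cLI h hI} (hx : x ∈ iHighest cL cLI h hI) (m : ℕ) :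
    opW cL cLI h hI (-((m : ℤ) + 1)) x = (2 * hI + 2 * cLI * m) • I (-((m : ℤ) + 1)) • x +
      ∑ j ∈ Finset.range m, I (-((j : ℤ) + 1)) • I (-(((m - 1 - j : ℕ) : ℤ) + 1)) • x := by
  classical
  have hsum : (∑ᶠ i : ℤ, I i • I (-((m : ℤ) + 1) - i) • x) =
      ∑ j ∈ Finset.range (m + 2), I (-(j : ℤ)) • I (-((m : ℤ) + 1) - -(j : ℤ)) • x := by
    rw [finsum_eq_sum_of_support_subset (s := (Finset.range (m + 2)).image fun j : ℕ => -(j : ℤ))]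
    · rw [Finset.sum_image fun a _ b _ h => by simpa using h]
    · intro k hk
      rw [Function.mem_support] at hk
      simp only [Finset.coe_image, Set.mem_image, Finset.mem_coe, Finset.mem_range]
      have h0 : k ≤ 0 := by
        by_contra h
        exact hk (by rw [I_smul_I_smul, hx.1 k (by omega), smul_zero])
      refine ⟨(-k).toNat, ?_, by omega⟩
      by_contra h
      exact hk (by rw [hx.1 (-((m : ℤ) + 1) - k) (by omega), smul_zero])
  rw [opW_apply, hsum, Finset.sum_range_succ, Finset.sum_range_succ']
  have h1 : -((m : ℤ) + 1) - -((m + 1 : ℕ) : ℤ) = 0 := by push_cast; ring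
  have h2 : -((m : ℤ) + 1) - -((0 : ℕ) : ℤ) = -((m : ℤ) + 1) := by simp
  have h3 : ∀ j ∈ Finset.range m, I (-((j + 1 : ℕ) : ℤ)) •
      I (-((m : ℤ) + 1) - -((j + 1 : ℕ) : ℤ)) • x =
      I (-((j : ℤ) + 1)) • I (-(((m - 1 - j : ℕ) : ℤ) + 1)) • x := by
    intro j hj
    rw [Finset.mem_range] at hj
    congr 2
    congr 1
    omega
  rw [Finset.sum_congr rfl h3, h1, h2, hx.2, Nat.cast_zero, neg_zero,
    (I_smul_mem_iHighest _ hx).2, smul_comm (I _) hI,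
    show -((m + 1 : ℕ) : ℤ) = -((m : ℤ) + 1) by push_cast; ring]
  generalize I (-((m : ℤ) + 1)) • x = y
  generalize ∑ j ∈ Finset.range m,
    I (-((j : ℤ) + 1)) • I (-(((m - 1 - j : ℕ) : ℤ) + 1)) • x = w
  push_cast
  module

end HVir

/-! ### Graded surjections with finite-dimensional pieces -/

/-- A surjective endomorphism that respects a grading with finitely many basis vectors in each
degree is injective. -/
theorem Module.Basis.injective_of_surjective_of_graded {A F : Type*} [AddCommGroup F] [Module ℂ F]
    (b : Module.Basis A ℂ F) (wt : A → ℕ) (hwt : ∀ n, {a | wt a = n}.Finite) (G : Module.End ℂ F)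
    (hG : ∀ a c, wt c ≠ wt a → b.repr (G (b a)) c = 0) (hsurj : Function.Surjective G) :
    Function.Injective G := by
  classical
  -- The projection onto weight n; it commutes with `G`, which reduces the claim to
  -- finite-dimensional weight spaces.
  let π (n : ℕ) : F →ₗ[ℂ] F := b.constr ℂ fun a => if wt a = n then b a else 0
  have hπ (n : ℕ) (a : A) : π n (b a) = if wt a = n then b a else 0 := b.constr_basis ℂ _ a
  have hrepr (n : ℕ) (x : F) (c : A) : b.repr (π n x) c = if wt c = n then b.repr x c else 0 := by
    have h : (Finsupp.lapply c ∘ₗ b.repr.toLinearMap) ∘ₗ π n =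
        (if wt c = n then (1 : ℂ) else 0) • (Finsupp.lapply c ∘ₗ b.repr.toLinearMap) := by
      refine b.ext fun a => ?_
      simp only [LinearMap.comp_apply, LinearMap.smul_apply, hπ]
      by_cases hac : a = c
      · subst hac
        split_ifs <;> simp
      · split_ifs <;> simp [hac]
    have h' := LinearMap.congr_fun h x
    rw [LinearMap.smul_apply, ite_smul, one_smul, zero_smul] at h'
    exact h'
  have hπG (n : ℕ) (x : F) : π n (G x) = G (π n x) := by
    have h : π n ∘ₗ G = G ∘ₗ π n := by
      refine b.ext fun a => b.ext_elem fun c => ?_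
      rw [LinearMap.comp_apply, LinearMap.comp_apply, hrepr, hπ]
      by_cases h1 : wt c = wt a
      · rw [h1]
        split_ifs <;> simp
      · rw [hG a c h1, ite_self]
        split_ifs
        · rw [hG a c h1]
        · simp
    exact LinearMap.congr_fun h x
  have hV (n : ℕ) (x : F) : x ∈ Submodule.span ℂ (b '' {a | wt a = n}) ↔ π n x = x := by
    rw [b.mem_span_image]
    constructor
    · intro hx
      refine b.ext_elem fun c => ?_
      rw [hrepr]
      split_ifs with hc
      · rfl
      · by_contra h0
        exact hc (hx (Finsupp.mem_support_iff.2 (Ne.symm h0)))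
    · intro hx c hc
      by_contra h0
      refine Finsupp.mem_support_iff.1 hc ?_
      rw [← hx, hrepr]
      exact if_neg h0
  have hππ (n : ℕ) (x : F) : π n (π n x) = π n x := by
    refine b.ext_elem fun c => ?_
    rw [hrepr, hrepr]
    split_ifs <;> rfl
  rw [injective_iff_map_eq_zero]
  intro x hx
  refine b.ext_elem fun c => ?_
  have hfin : FiniteDimensional ℂ (Submodule.span ℂ (b '' {a | wt a = wt c})) :=
    FiniteDimensional.span_of_finite ℂ ((hwt (wt c)).image b)
  have hmaps : ∀ y ∈ Submodule.span ℂ (b '' {a | wt a = wt c}),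
      G y ∈ Submodule.span ℂ (b '' {a | wt a = wt c}) := fun y hy => by
    rw [hV] at hy ⊢
    rw [hπG, hy]
  have hs : Function.Surjective (G.restrict hmaps) := by
    rintro ⟨y, hy⟩
    obtain ⟨w, rfl⟩ := hsurj y
    refine ⟨⟨π (wt c) w, (hV _ _).2 (hππ _ _)⟩, Subtype.ext ?_⟩
    rw [LinearMap.coe_restrict_apply, ← hπG, (hV _ _).1 hy]
  have h0 : (⟨π (wt c) x, (hV _ _).2 (hππ _ _)⟩ :
      Submodule.span ℂ (b '' {a | wt a = wt c})) = 0 := by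
    refine LinearMap.injective_iff_surjective.2 hs (Subtype.ext ?_)
    rw [LinearMap.coe_restrict_apply, ← hπG, hx, map_zero, map_zero]
    rfl
  have h1 : π (wt c) x = 0 := congrArg Subtype.val h0
  have h2 := hrepr (wt c) x c
  rw [h1, if_pos rfl] at h2
  rw [← h2]

namespace Fock

/-- The weight of a multiset of variables: the variable `(s, m)` has weight `m + 1`. -/
def weight (m : Multiset (Bool × ℕ)) : ℕ := (m.map fun i => i.2 + 1).sum

theorem finite_weight_eq (n : ℕ) : {m | weight m = n}.Finite := by
  classical
  -- In weight n each variable has multiplicity at most n and index below n, so the multiset lies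
  -- below n copies of all such variables.
  refine (Set.finite_Iic (n • (Finset.univ ×ˢ Finset.range n : Finset (Bool × ℕ)).val)).subset
    fun m hm => ?_
  change weight m = n at hm
  rw [weight] at hm
  have hle (i : Bool × ℕ) : m.count i * (i.2 + 1) ≤ n := by
    obtain ⟨t, ht⟩ := le_iff_exists_add.1
      (Multiset.le_count_iff_replicate_le.1 (le_refl (m.count i)))
    have h := congrArg (fun s : Multiset (Bool × ℕ) => (s.map fun i => i.2 + 1).sum) ht
    simp only [Multiset.map_add, Multiset.map_replicate, Multiset.sum_add,
      Multiset.sum_replicate, smul_eq_mul, hm] at h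
    omega
  rw [Set.mem_Iic, Multiset.le_iff_count]
  intro i
  rw [Multiset.count_nsmul]
  by_cases hi : i ∈ m
  · have h1 := Multiset.one_le_count_iff_mem.2 hi
    have h2 : i ∈ (Finset.univ ×ˢ Finset.range n : Finset (Bool × ℕ)).val := by
      rw [Finset.mem_val, Finset.mem_product, Finset.mem_range]
      exact ⟨Finset.mem_univ _, by nlinarith [hle i]⟩
    rw [Multiset.count_eq_one_of_mem (Finset.nodup _) h2]
    nlinarith [hle i]
  · rw [Multiset.count_eq_zero_of_notMem hi]
    exact Nat.zero_le _

end Fock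

/-! ### Monomial basis and generation of the Fock space by Virasoro modes -/

namespace Fock

open MvPolynomial

/-- The basis of monomials of the Fock space, indexed by multisets of variables. -/
noncomputable def monomialBasis : Module.Basis (Multiset (Bool × ℕ)) ℂ Fock :=
  (basisMonomials (Bool × ℕ) ℂ).reindex Multiset.toFinsupp.symm.toEquiv

theorem monomialBasis_apply (m : Multiset (Bool × ℕ)) : monomialBasis m = (m.map X).prod := by
  have h : monomialBasis m = monomial (Multiset.toFinsupp m) 1 := by
    rw [monomialBasis, Module.Basis.reindex_apply, coe_basisMonomials]
    rfl
  rw [h]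
  clear h
  induction m using Multiset.induction_on with
  | empty => simp
  | cons i m ih =>
    rw [Multiset.map_cons, Multiset.prod_cons, ← ih, ← Multiset.singleton_add, map_add,
      Multiset.toFinsupp_singleton, ← one_mul (1 : ℂ), ← monomial_mul, one_mul]
    rfl

variable (z ρ : Bool → ℂ)

theorem vir_zero_monomialBasis (m : Multiset (Bool × ℕ)) :
    vir z ρ 0 (monomialBasis m) = (lowestWeight z ρ + weight m) • monomialBasis m := by
  rw [monomialBasis_apply]
  induction m using Multiset.induction_on with
  | empty => simp [vir_zero_one, weight]
  | cons i m ih =>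
    rw [Multiset.map_cons, Multiset.prod_cons, vir_zero_X_mul, ih, mul_smul_comm, ← add_smul]
    congr 1
    simp only [weight, Multiset.map_cons, Multiset.sum_cons]
    push_cast
    ring

/-- Monomials diagonalise `vir z ρ 0`, with eigenvalues separated by weight; an eigenvector thus
involves only monomials of its own weight. -/
theorem repr_eq_zero_of_vir_zero {f : Fock} {k : ℕ}
    (hf : vir z ρ 0 f = (lowestWeight z ρ + k) • f) (c : Multiset (Bool × ℕ)) (hc : weight c ≠ k) :
    monomialBasis.repr f c = 0 := by
  have h : (Finsupp.lapply c ∘ₗ monomialBasis.repr.toLinearMap) ∘ₗ vir z ρ 0 =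
      (lowestWeight z ρ + weight c) • (Finsupp.lapply c ∘ₗ monomialBasis.repr.toLinearMap) := by
    classical
    refine monomialBasis.ext fun a => ?_
    simp only [LinearMap.comp_apply, LinearMap.smul_apply, vir_zero_monomialBasis, map_smul]
    by_cases hac : a = c
    · rw [hac]
    · simp [hac]
  have h' := LinearMap.congr_fun h f
  simp only [LinearMap.comp_apply, LinearMap.smul_apply, hf, map_smul, LinearEquiv.coe_coe,
    Finsupp.lapply_apply, smul_eq_mul] at h'
  rw [← sub_eq_zero, ← sub_mul, add_sub_add_left_eq_sub, mul_eq_zero, sub_eq_zero,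
    Nat.cast_inj] at h'
  exact h'.resolve_left hc.symm

theorem vir_neg_X_mul (n : ℕ) (i : Bool × ℕ) (f : Fock) :
    vir z ρ (-((n : ℤ) + 1)) (X i * f) = X i * vir z ρ (-((n : ℤ) + 1)) f +
      ((i.2 : ℂ) + 1) • (X (i.1, i.2 + n + 1) * f) := by
  rw [← current_neg z i.1 i.2, vir_current, if_neg (by omega), zero_smul, add_zero, current_neg,
    show -((n : ℤ) + 1) + -((i.2 : ℤ) + 1) = -(((i.2 + n + 1 : ℕ) : ℤ) + 1) by push_cast; ring,
    current_neg]
  push_cast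
  rw [neg_neg]

theorem vir_neg_one (n : ℕ) : vir z ρ (-((n : ℤ) + 1)) 1 =
    (z true - ρ false * n) • X (false, n) + (z false - ρ true * n) • X (true, n) +
      ∑ j ∈ Finset.range n, X (true, j) * X (false, n - 1 - j) := by
  have hq := quad_neg_one z (n + 1)
  rw [Finset.sum_range_succ, Finset.sum_range_succ'] at hq
  have h1 : normalProd z (-((n + 1 : ℕ) : ℤ)) (-((n + 1 : ℕ) : ℤ)) 1 =
      z false • X (true, n) := by
    rw [normalProd, if_pos (by omega), sub_self, current_zero, map_smul, Nat.cast_add_one,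
      current_neg, mul_one]
  have h2 : normalProd z (-((n + 1 : ℕ) : ℤ)) (-((0 : ℕ) : ℤ)) 1 = z true • X (false, n) := by
    rw [normalProd, if_neg (by omega), Nat.cast_zero, neg_zero, sub_zero, current_zero, map_smul,
      Nat.cast_add_one, current_neg, mul_one]
  have h3 : ∀ j ∈ Finset.range n, normalProd z (-((n + 1 : ℕ) : ℤ)) (-((j + 1 : ℕ) : ℤ)) 1 =
      X (true, j) * X (false, n - 1 - j) := by
    intro j hj
    rw [Finset.mem_range] at hj
    rw [normalProd, if_pos (by omega),
      show -((n + 1 : ℕ) : ℤ) - -((j + 1 : ℕ) : ℤ) = -(((n - 1 - j : ℕ) : ℤ) + 1) by omega,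
      Nat.cast_add_one, current_neg, current_neg, mul_one]
  rw [Finset.sum_congr rfl h3, h1, h2, Nat.cast_add_one] at hq
  rw [vir_apply, hq, current_neg, current_neg, mul_one, mul_one]
  push_cast
  module

/-- The span of the monomials of degree at most `D` in the variables `(false, m)`. -/
noncomputable def degreeLE (D : ℕ) : Submodule ℂ Fock :=
  Submodule.span ℂ {f | ∃ l : List (Bool × ℕ), l.countP (fun i => !i.1) ≤ D ∧ (l.map X).prod = f}

theorem X_mul_mem_degreeLE (i : Bool × ℕ) (D k : ℕ) (hk : D + (if i.1 then 0 else 1) ≤ k)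
    {f : Fock} (hf : f ∈ degreeLE D) : X i * f ∈ degreeLE k := by
  induction hf using Submodule.span_induction with
  | mem f hf =>
    obtain ⟨l, hl, rfl⟩ := hf
    refine Submodule.subset_span ⟨i :: l, ?_, by simp⟩
    rw [List.countP_cons]
    rcases i with ⟨_ | _, m⟩ <;> simp at hk ⊢ <;> omega
  | zero => rw [mul_zero]; exact Submodule.zero_mem _
  | add f g _ _ hf hg => rw [mul_add]; exact Submodule.add_mem _ hf hg
  | smul t f _ hf => rw [mul_smul_comm]; exact Submodule.smul_mem _ _ hf

/-- The commutator with a variable raises its index but keeps its current, so the number of `false`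
variables does not grow. -/
theorem vir_neg_sub_prod_mem_degreeLE (n : ℕ) (l : List (Bool × ℕ)) :
    vir z ρ (-((n : ℤ) + 1)) (l.map X).prod - (l.map X).prod * vir z ρ (-((n : ℤ) + 1)) 1 ∈
      degreeLE (l.countP fun i => !i.1) := by
  induction l with
  | nil =>
    rw [List.map_nil, List.prod_nil, one_mul, sub_self]
    exact Submodule.zero_mem _
  | cons i l ih =>
    have hi : l.countP (fun i => !i.1) + (if i.1 then 0 else 1) ≤
        (i :: l).countP fun i => !i.1 := by
      rw [List.countP_cons]
      rcases i with ⟨_ | _, m⟩ <;> simp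
    have h1 := X_mul_mem_degreeLE i _ _ hi ih
    have h2 := X_mul_mem_degreeLE (i.1, i.2 + n + 1) _ _ hi
      (Submodule.subset_span ⟨l, le_rfl, rfl⟩ : (l.map X).prod ∈ degreeLE _)
    have h3 := Submodule.add_mem _ h1 (Submodule.smul_mem _ ((i.2 : ℂ) + 1) h2)
    rw [List.map_cons, List.prod_cons, vir_neg_X_mul, add_sub_right_comm, mul_assoc, ← mul_sub]
    exact h3

theorem vir_neg_sub_mem_degreeLE (n D : ℕ) {f : Fock} (hf : f ∈ degreeLE D) :
    vir z ρ (-((n : ℤ) + 1)) f - f * vir z ρ (-((n : ℤ) + 1)) 1 ∈ degreeLE D := by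
  induction hf using Submodule.span_induction with
  | mem f hf =>
    obtain ⟨l, hl, rfl⟩ := hf
    refine Submodule.span_mono ?_ (vir_neg_sub_prod_mem_degreeLE z ρ n l)
    rintro _ ⟨l', hl', rfl⟩
    exact ⟨l', hl'.trans hl, rfl⟩
  | zero =>
    rw [map_zero, zero_mul, sub_self]
    exact Submodule.zero_mem _
  | add f g _ _ hf hg =>
    rw [map_add, add_mul, add_sub_add_comm]
    exact Submodule.add_mem _ hf hg
  | smul t f _ hf =>
    rw [map_smul, smul_mul_assoc, ← smul_sub]
    exact Submodule.smul_mem _ _ hf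

/-- A subspace that is stable under the negative Virasoro modes and contains all polynomials in
the variables `(true, m)` is everything, for generic zero modes. -/
theorem eq_top_of_vir_mem (R : Submodule ℂ Fock)
    (hz : ∀ n : ℕ, z true - ρ false * n ≠ 0) (h0 : degreeLE 0 ≤ R)
    (hR : ∀ n : ℕ, ∀ f ∈ R, vir z ρ (-((n : ℤ) + 1)) f ∈ R) : R = ⊤ := by
  -- Modulo `degreeLE D` the Virasoro mode multiplies f by its value on 1, whose coefficient at
  -- X(false, n) is the nonzero `z true - ρ false * n`. The quadratic terms contain only X(false, j)
  -- with j < n, and their `true` factor is absorbed into f.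
  have hstep : ∀ D : ℕ, degreeLE D ≤ R → ∀ n : ℕ, ∀ f ∈ degreeLE D, X (false, n) * f ∈ R := by
    intro D hD n
    induction n using Nat.strong_induction_on with
    | _ n ih =>
      intro f hf
      have h1 := hD (vir_neg_sub_mem_degreeLE z ρ n D hf)
      have h2 := R.sub_mem (hR n f (hD hf)) h1
      rw [sub_sub_cancel, vir_neg_one, mul_add, mul_add, mul_smul_comm, mul_smul_comm,
        Finset.mul_sum] at h2
      have h3 : ∑ j ∈ Finset.range n, f * (X (true, j) * X (false, n - 1 - j)) ∈ R := by
        refine R.sum_mem fun j hj => ?_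
        rw [Finset.mem_range] at hj
        rw [mul_left_comm, mul_comm f, mul_left_comm]
        exact ih _ (by omega) _ (X_mul_mem_degreeLE _ D D (by simp) hf)
      have h4 : (z false - ρ true * n) • (f * X (true, n)) ∈ R := by
        rw [mul_comm f]
        exact R.smul_mem _ (hD (X_mul_mem_degreeLE _ D D (by simp) hf))
      have h5 := (R.add_mem_iff_left h4).1 ((R.add_mem_iff_left h3).1 h2)
      rw [mul_comm]
      exact (R.smul_mem_iff (hz n)).1 h5
  have hall : ∀ D : ℕ, degreeLE D ≤ R := by
    intro D
    induction D with
    | zero => exact h0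
    | succ D ih =>
      refine Submodule.span_le.2 ?_
      rintro _ ⟨l, hl, rfl⟩
      rcases Nat.lt_or_ge (l.countP fun i => !i.1) (D + 1) with h | h
      · exact ih (Submodule.subset_span ⟨l, by omega, rfl⟩)
      · obtain ⟨⟨s, n⟩, hmem, hs⟩ := List.countP_pos_iff.1 (by omega : 0 < l.countP fun i => !i.1)
        obtain rfl : s = false := by simpa using hs
        have hp := List.perm_cons_erase hmem
        have hc := hp.countP_eq (fun i => !i.1)
        rw [List.countP_cons] at hc
        simp only [Bool.not_false, if_true] at hc
        rw [SetLike.mem_coe, (hp.map X).prod_eq, List.map_cons, List.prod_cons]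
        exact hstep D ih n _ (Submodule.subset_span ⟨_, by omega, rfl⟩)
  rw [eq_top_iff, ← monomialBasis.span_eq, Submodule.span_le]
  rintro _ ⟨m, rfl⟩
  refine hall _ (Submodule.subset_span ⟨m.toList, le_rfl, ?_⟩)
  rw [monomialBasis_apply, ← Multiset.prod_coe, ← Multiset.map_coe, Multiset.coe_toList]

end Fock

/-! ### Injectivity of Ψ and the singular vector -/

section MainTheorem

variable {cL cW cLI h hW hI : ℂ}

/-- Solve the triangular relation `opW_neg` for I(-m-1): its coefficient is invertible and the
quadratic terms are covered by applying the induction hypothesis twice. The intersection with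
`HVir.iHighest` is needed because the relation holds only there. -/
theorem I_smul_mem_range_Psi (hcW : cW = -24 * cLI ^ 2) (hhW : hW = hI * (hI - 2 * cLI))
    (hc : ∀ m : ℕ, 2 * hI + 2 * cLI * m ≠ 0) (m : ℕ) :
    ∀ x ∈ LinearMap.range (Psi (cL := cL) (h := h) hcW hhW) ⊓ HVir.iHighest cL cLI h hI,
      HVir.I (-((m : ℤ) + 1)) • x ∈
        LinearMap.range (Psi (cL := cL) (h := h) hcW hhW) ⊓ HVir.iHighest cL cLI h hI := by
  induction m using Nat.strong_induction_on with
  | _ m ih =>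
    rintro x ⟨⟨y, rfl⟩, hx⟩
    refine ⟨?_, HVir.I_smul_mem_iHighest _ hx⟩
    have h1 := HVir.opW_neg hx m
    rw [← w22Action_W, ← Psi_smul, ← sub_eq_iff_eq_add] at h1
    refine (Submodule.smul_mem_iff _ (hc m)).1 ?_
    rw [← h1]
    refine Submodule.sub_mem _ ⟨_, rfl⟩ (Submodule.sum_mem _ fun j hj => ?_)
    rw [Finset.mem_range] at hj
    exact (ih j hj _ (ih _ (by omega) _ ⟨⟨y, rfl⟩, hx⟩)).1

/-- The composite Φ to the Fock space is onto, and T, which sends monomials to words, is onto the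
W(2,2) Verma module. So Φ ∘ T is a graded surjective endomorphism of the Fock space, hence
injective; since T is onto, Φ and with it Ψ are injective. -/
theorem Psi_injective (hcW : cW = -24 * cLI ^ 2) (hhW : hW = hI * (hI - 2 * cLI))
    (z ρ : Bool → ℂ) (hcL : cL = 2 - 24 * (ρ true * ρ false)) (hcLI : cLI = -ρ false)
    (hh : h = Fock.lowestWeight z ρ) (hhI : hI = z true)
    (hc : ∀ m : ℕ, 2 * hI + 2 * cLI * m ≠ 0) :
    Function.Injective (Psi (cL := cL) (h := h) hcW hhW) := by
  set Φ : W22.Verma cL cW h hW →ₗ[ℂ] Fock :=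
    (Fock.ofVerma z ρ hcL hcLI hh hhI).comp (Psi hcW hhW) with hΦ
  have hΦL (n : ℤ) (y : W22.Verma cL cW h hW) : Φ (W22.L n • y) = Fock.vir z ρ n (Φ y) := by
    rw [hΦ, LinearMap.comp_apply, LinearMap.comp_apply, Psi_smul, w22Action_L]
    exact Fock.ofVerma_L z ρ hcL hcLI hh hhI n _
  have hrange : LinearMap.range Φ = ⊤ := by
    refine Fock.eq_top_of_vir_mem z ρ _ (fun n h0 => hc n ?_) ?_ ?_
    · rw [hhI, hcLI]
      linear_combination 2 * h0
    · refine Submodule.span_le.2 ?_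
      rintro _ ⟨l, hl, rfl⟩
      suffices hl' : ∃ x ∈ LinearMap.range (Psi (cL := cL) (h := h) hcW hhW) ⊓
          HVir.iHighest cL cLI h hI, Fock.ofVerma z ρ hcL hcLI hh hhI x =
            (l.map MvPolynomial.X).prod by
        obtain ⟨x, ⟨⟨y, rfl⟩, -⟩, hx⟩ := hl'
        exact ⟨y, hx⟩
      induction l with
      | nil =>
        exact ⟨HVir.hwv cL 0 cLI h hI, ⟨⟨_, Psi_hwv hcW hhW⟩, HVir.hwv_mem_iHighest⟩,
          Fock.ofVerma_hwv z ρ hcL hcLI hh hhI⟩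
      | cons i l ih =>
        rw [List.countP_cons] at hl
        obtain ⟨x, hx, hxl⟩ := ih (by omega)
        rcases i with ⟨_ | _, m⟩
        · simp at hl
        · refine ⟨_, I_smul_mem_range_Psi hcW hhW hc m x hx, ?_⟩
          rw [Fock.ofVerma_I, hxl, Fock.current_neg, List.map_cons, List.prod_cons]
    · rintro n _ ⟨y, rfl⟩
      exact ⟨_, hΦL _ y⟩
  let T : Fock →ₗ[ℂ] W22.Verma cL cW h hW :=
    Fock.monomialBasis.constr ℂ fun m => W22.word cL cW h hW m.toList
  have hT (m : Multiset (Bool × ℕ)) :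
      T (Fock.monomialBasis m) = W22.word cL cW h hW m.toList :=
    Fock.monomialBasis.constr_basis ℂ _ m
  have hTsurj : Function.Surjective T := by
    rw [← LinearMap.range_eq_top, eq_top_iff, ← W22.span_word_multiset, Submodule.span_le]
    rintro _ ⟨m, rfl⟩
    exact ⟨_, hT m⟩
  have hinj : Function.Injective (Φ ∘ₗ T) := by
    refine Fock.monomialBasis.injective_of_surjective_of_graded Fock.weight Fock.finite_weight_eq
      _ (fun a c hac => ?_) ((LinearMap.range_eq_top.1 hrange).comp hTsurj)
    refine Fock.repr_eq_zero_of_vir_zero z ρ ?_ c hac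
    have hw : (a.toList.map fun i => i.2 + 1).sum = Fock.weight a := by
      rw [Fock.weight, ← Multiset.sum_coe, ← Multiset.map_coe, Multiset.coe_toList]
    rw [LinearMap.comp_apply, hT, ← hΦL, W22.L_zero_smul_word, map_smul, hw]
    exact congrArg (fun t => (t + (Fock.weight a : ℂ)) • Φ (W22.word cL cW h hW a.toList)) hh
  intro x y hxy
  obtain ⟨f, rfl⟩ := hTsurj x
  obtain ⟨g, rfl⟩ := hTsurj y
  exact congrArg T (hinj (congrArg (Fock.ofVerma z ρ hcL hcLI hh hhI) hxy))

/-- In the Fock space, set every variable to -c_LI: each argument -I(-n)/c_LI becomes 1, and S_r(1,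
1, …) = 1 because exp(∑ yⁿ/n) = 1/(1 - y). -/
theorem schurVector_ne_zero (z ρ : Bool → ℂ) (hcL : cL = 2 - 24 * (ρ true * ρ false))
    (hcLI : cLI = -ρ false) (hh : h = Fock.lowestWeight z ρ) (hhI : hI = z true) (hc : cLI ≠ 0)
    (r : ℕ) : schurVector cL 0 cLI h hI r ≠ 0 := by
  have key : MvPolynomial.aeval (fun _ => -cLI)
      (Fock.ofVerma z ρ hcL hcLI hh hhI (schurVector cL 0 cLI h hI r)) = 1 := by
    induction r using Nat.strong_induction_on with
    | _ r ih =>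
      rcases Nat.eq_zero_or_pos r with rfl | hr
      · rw [HVir.schurVector_zero, Fock.ofVerma_hwv, map_one]
      · have h1 : (r : ℂ) ≠ 0 := Nat.cast_ne_zero.2 (by omega)
        have h2 := congrArg (fun x => MvPolynomial.aeval (fun _ => -cLI)
          (Fock.ofVerma z ρ hcL hcLI hh hhI x))
          (HVir.smul_schurVector (cL := cL) (cLI := cLI) (h := h) (hI := hI) r)
        simp only [map_smul, map_sum, Fock.ofVerma_I, Fock.current_neg, map_mul,
          MvPolynomial.aeval_X, smul_eq_mul] at h2
        rw [Finset.sum_congr rfl (g := fun _ => (1 : ℂ)), Finset.sum_const, Finset.card_range,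
          nsmul_eq_mul] at h2
        · exact mul_left_cancel₀ h1 h2
        · intro k hk
          rw [Finset.mem_range] at hk
          rw [ih (r - 1 - k) (by omega)]
          field_simp
  intro h0
  rw [h0, map_zero, map_zero] at key
  exact zero_ne_one key

end MainTheorem

theorem mainTheorem6 (p : ℕ) (hp : 0 < p) (cL cW cLI h hW hI : ℂ) (hcLI : cLI ≠ 0)
    (hratio : hW / cW = (1 - (p : ℂ) ^ 2) / 24)
    (hcW : cW = -24 * cLI ^ 2) (hhW : hW = hI * (hI - 2 * cLI))
    (hhI : hI / cLI - 1 = p) :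
    ∃ u : W22.Verma cL cW h hW,
      Psi hcW hhW ⁻¹' {schurVector cL 0 cLI h hI p} = {u} ∧ W22.IsSingularVector u p := by
  have hp0 : (p : ℂ) ≠ 0 := Nat.cast_ne_zero.2 hp.ne'
  have hI' : hI = ((p : ℂ) + 1) * cLI := by
    rw [← hhI]
    field_simp
    ring
  have hc (m : ℕ) : 2 * hI + 2 * cLI * m ≠ 0 := by
    rw [hI', show 2 * (((p : ℂ) + 1) * cLI) + 2 * cLI * m = 2 * cLI * ((p + m : ℕ) + 1) by
      push_cast; ring]
    exact mul_ne_zero (mul_ne_zero two_ne_zero hcLI) (Nat.cast_add_one_ne_zero _)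
  obtain ⟨z, ρ, e1, e2, e3, e4⟩ : ∃ z ρ : Bool → ℂ, cL = 2 - 24 * (ρ true * ρ false) ∧
      cLI = -ρ false ∧ h = Fock.lowestWeight z ρ ∧ hI = z true := by
    -- The charges are forced: ρ(false) = -c_LI, then ρ(true) from the central charge. With h_I = (p
    -- + 1) c_LI the lowest weight is p c_LI z(false) + ρ(true) h_I, which is solvable for z(false)
    -- because p ≠ 0.
    refine ⟨fun s => if s then hI else (h - (cL - 2) / (24 * cLI) * hI) / (p * cLI),
      fun s => if s then (cL - 2) / (24 * cLI) else -cLI, ?_, ?_, ?_, ?_⟩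
    · simp only [if_true, Bool.false_eq_true, if_false]
      field_simp
      ring
    · simp
    · simp only [Fock.lowestWeight, if_true, Bool.false_eq_true, if_false]
      rw [hI']
      field_simp
      ring
    · simp
  have hinj := Psi_injective hcW hhW z ρ e1 e2 e3 e4 hc
  obtain ⟨u, hu⟩ : schurVector cL 0 cLI h hI p ∈
      LinearMap.range (Psi (cL := cL) (h := h) hcW hhW) :=
    (HVir.schurVector_mem (LinearMap.range (Psi (cL := cL) (h := h) hcW hhW) ⊓
      HVir.iHighest cL cLI h hI) ⟨⟨_, Psi_hwv hcW hhW⟩, HVir.hwv_mem_iHighest⟩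
      (I_smul_mem_range_Psi hcW hhW hc) p).1
  have hs := HVir.schurVector_mem_iHighest (cL := cL) (cLI := cLI) (h := h) (hI := hI) p
  -- Each singular vector equation is checked after applying the injective intertwiner Ψ; the `W
  -- 0`-eigenvalue is that of the highest weight vector, since u maps to an I-highest vector.
  refine ⟨u, ?_, ?_, fun n hn => hinj ?_, fun n hn => hinj ?_, hinj ?_, hI * (hI - 2 * cLI),
    hinj ?_⟩
  · ext x
    rw [Set.mem_preimage, Set.mem_singleton_iff, Set.mem_singleton_iff, ← hu]
    exact hinj.eq_iff
  · rintro rfl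
    exact schurVector_ne_zero z ρ e1 e2 e3 e4 hcLI p (by rw [← hu, map_zero])
  · rw [Psi_smul, w22Action_L, hu, map_zero]
    exact HVir.L_pos_smul_schurVector hcLI hI' n hn
  · rw [Psi_smul, w22Action_W, hu, map_zero]
    exact HVir.opW_pos hs n hn
  · rw [Psi_smul, w22Action_L, map_smul, hu]
    exact HVir.L_zero_smul_schurVector p
  · rw [Psi_smul, w22Action_W, map_smul, hu]
    exact HVir.opW_zero hs
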